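/- Let $M$ be a smooth manifold. For a 1-form $\alpha$, write $\ker d\alpha=\{v: d\alpha(v,\cdot)=0\}$. A pair $(\alpha_1,\alpha_2)$ of smooth 1-forms on $M$ is a contact pair of type $(h,k)$, with $h,k\ge 0$ integers, if $\alpha_1\wedge(d\alpha_1)^h\wedge\alpha_2\wedge(d\alpha_2)^k$ is a volume form (a nowhere vanishing form of degree $\dim M$), $(d\alpha_1)^{h+1}=0$ and $(d\alpha_2)^{k+1}=0$. Its Reeb vector fields $Z_1,Z_2$ are the unique vector fields with $\alpha_i(Z_j)=\delta_{ij}$ and $i_{Z_j}d\alpha_i=0$ for $i,j\in\{1,2\}$. A metric contact pair of type $(h,k)$ on $M$ is a quadruple $(\alpha_1,\alpha_2,\phi,g)$ in which $(\alpha_1,\alpha_2)$ is a contact pair of type $(h,k)$, $\phi$ is a smooth field of endomorphisms of $TM$ with $$\phi^2=-\mathrm{Id}+\alpha_1\otimes Z_1+\alpha_2\otimes Z_2,\qquad \phi(Z_1)=\phi(Z_2)=0,$$ and $g$ is a Riemannian metric on $M$ with $g(X,\phi Y)=(d\alpha_1+d\alpha_2)(X,Y)$ and $g(X,Z_i)=\alpha_i(X)$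 for $i=1,2$ and all vector fields $X,Y$. The tensor $\phi$ is called decomposable if $\phi(\ker\alpha_i\cap\ker d\alpha_i)\subset\ker\alpha_i\cap\ker d\alpha_i$ for $i=1,2$. **Theorem.** Let $(\alpha_1,\alpha_2,\phi,g)$ be a metric contact pair of type $(h,k)$ on $M$ and suppose that $\phi$ is decomposable. Then $(\alpha_1,\alpha_2,\phi,g)$ induces a metric contact pair of type $(h,0)$ on every leaf of the characteristic foliation of $d\alpha_2$ (the foliation tangent to $\ker d\alpha_2$), and one of type $(0,k)$ on every leaf of the characteristic foliation of $d\alpha_1$ (the foliation tangent to $\ker d\alpha_1$). Here a leaf is a maximal connected injectively immersed integral manifold $\iota:L\to M$ of the distribution, and "induces" means that $\phi$ preserves the tangent spaces of $L$ and that $(\iota^*\alpha_1,\iota^*\alpha_2,\phi|_{TL},\iota^*g)$ is a metric contact pair of the stated type on $L$. -/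

import Mathlib

open Set Bundle Manifold
open scoped ContDiff Manifold Topology

universe u

noncomputable section

namespace ContactPair

/-! ### Exterior algebra on a real vector space -/

section Linear

variable {V : Type*} [AddCommGroup V] [Module ℝ V]

/-- The wedge product of a `p`-form and a `q`-form, as a sum over shuffles, so that
`(a ∧ b)(v, w) = a v * b w - a w * b v` for `1`-forms. -/
def wedge {p q : ℕ} (a : V [⋀^Fin p]→ₗ[ℝ] ℝ) (b : V [⋀^Fin q]→ₗ[ℝ] ℝ) :
    V [⋀^Fin (p + q)]→ₗ[ℝ] ℝ :=
  ((LinearMap.mul' ℝ ℝ).compAlternatingMap (a.domCoprod b)).domDomCongr finSumFinEquiv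

/-- The exterior power `η ∧ ⋯ ∧ η` (`m` factors) of a `2`-form. -/
def wedgePow (η : V [⋀^Fin 2]→ₗ[ℝ] ℝ) : (m : ℕ) → V [⋀^Fin (2 * m)]→ₗ[ℝ] ℝ
  | 0 => AlternatingMap.constOfIsEmpty ℝ V (Fin 0) 1
  | m + 1 => wedge (wedgePow η m) η

/-- A linear form regarded as an alternating `1`-form. -/
def ofCovector (a : V →ₗ[ℝ] ℝ) : V [⋀^Fin 1]→ₗ[ℝ] ℝ :=
  AlternatingMap.ofSubsingleton ℝ V ℝ (0 : Fin 1) a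

/-- The kernel `{v | η(v, w) = 0 for all w}` of a `2`-form. -/
def formKer (η : V [⋀^Fin 2]→ₗ[ℝ] ℝ) : Submodule ℝ V where
  carrier := {v | ∀ w, η ![v, w] = 0}
  zero_mem' w := η.map_coord_zero 0 rfl
  add_mem' {v v'} hv hv' w := by
    have h := η.map_vecCons_add ![w] v v'
    rw [h, hv w, hv' w, add_zero]
  smul_mem' c v hv w := by
    have h := η.map_vecCons_smul ![w] c v
    rw [h, hv w, smul_zero]

end Linear

/-! ### Tensor fields on a manifold without boundary modelled on `E` -/

section Manifold

variable {E : Type*} [NormedAddCommGroup E] [NormedSpace ℝ E]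
  {M : Type*} [TopologicalSpace M] [ChartedSpace E M] [IsManifold 𝓘(ℝ, E) ∞ M]

/-- Smoothness of a field of linear forms, i.e. of a section of the cotangent bundle. -/
def SmoothOneForm (α : ∀ x : M, TangentSpace 𝓘(ℝ, E) x →L[ℝ] ℝ) : Prop :=
  ContMDiff 𝓘(ℝ, E) (𝓘(ℝ, E).prod 𝓘(ℝ, E →L[ℝ] ℝ)) ∞
    (fun x ↦ TotalSpace.mk' (E →L[ℝ] ℝ)
      (E := fun x : M ↦ TangentSpace 𝓘(ℝ, E) x →L[ℝ] ℝ) x (α x))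

/-- Smoothness of a vector field. -/
def SmoothVectorField (Z : ∀ x : M, TangentSpace 𝓘(ℝ, E) x) : Prop :=
  ContMDiff 𝓘(ℝ, E) 𝓘(ℝ, E).tangent ∞ (fun x ↦ (⟨x, Z x⟩ : TangentBundle 𝓘(ℝ, E) M))

/-- Smoothness of a tensor field of type `(1,1)`, i.e. of a field of endomorphisms of the
tangent bundle. -/
def SmoothEndomorphism
    (φ : ∀ x : M, TangentSpace 𝓘(ℝ, E) x →L[ℝ] TangentSpace 𝓘(ℝ, E) x) : Prop :=
  ContMDiff 𝓘(ℝ, E) (𝓘(ℝ, E).prod 𝓘(ℝ, E →L[ℝ] E)) ∞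
    (fun x ↦ TotalSpace.mk' (E →L[ℝ] E)
      (E := fun x : M ↦ TangentSpace 𝓘(ℝ, E) x →L[ℝ] TangentSpace 𝓘(ℝ, E) x) x (φ x))

/-- The expression of a `1`-form in the preferred chart at `x`: its pullback by the inverse of
the chart, a `1`-form on `E` (meaningful on the target of the chart). -/
def chartForm (α : ∀ x : M, TangentSpace 𝓘(ℝ, E) x →L[ℝ] ℝ) (x : M) (y : E) :
    E [⋀^Fin 1]→L[ℝ] ℝ :=
  ContinuousAlternatingMap.ofSubsingleton ℝ E ℝ (0 : Fin 1)
    ((α ((extChartAt 𝓘(ℝ, E) x).symm y)).comp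
      (mfderiv 𝓘(ℝ, E) 𝓘(ℝ, E) (extChartAt 𝓘(ℝ, E) x).symm y))

/-- The exterior derivative of a `1`-form at `x`: the exterior derivative of its expression in
the chart at `x`, pulled back by the chart. With this normalization
`dα(X, Y) = X(α(Y)) - Y(α(X)) - α([X, Y])`. -/
def extD (α : ∀ x : M, TangentSpace 𝓘(ℝ, E) x →L[ℝ] ℝ) (x : M) :
    TangentSpace 𝓘(ℝ, E) x [⋀^Fin 2]→ₗ[ℝ] ℝ :=
  (extDeriv (chartForm α x) (extChartAt 𝓘(ℝ, E) x x)).toAlternatingMap.compLinearMap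
    (mfderiv 𝓘(ℝ, E) 𝓘(ℝ, E) (extChartAt 𝓘(ℝ, E) x) x).toLinearMap

/-- The form `α₁ ∧ (dα₁)^h ∧ α₂ ∧ (dα₂)^k` at `x`. -/
def contactPairForm (α₁ α₂ : ∀ x : M, TangentSpace 𝓘(ℝ, E) x →L[ℝ] ℝ) (h k : ℕ) (x : M) :
    TangentSpace 𝓘(ℝ, E) x [⋀^Fin (1 + 2 * h + 1 + 2 * k)]→ₗ[ℝ] ℝ :=
  wedge (wedge (wedge (ofCovector (α₁ x).toLinearMap) (wedgePow (extD α₁ x) h))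
    (ofCovector (α₂ x).toLinearMap)) (wedgePow (extD α₂ x) k)

/-- `(α₁, α₂)` is a contact pair of type `(h, k)`: `α₁ ∧ (dα₁)^h ∧ α₂ ∧ (dα₂)^k` is a volume
form (a nowhere vanishing form of degree equal to the dimension), `(dα₁)^(h+1) = 0` and
`(dα₂)^(k+1) = 0`. -/
structure IsContactPair (α₁ α₂ : ∀ x : M, TangentSpace 𝓘(ℝ, E) x →L[ℝ] ℝ) (h k : ℕ) :
    Prop where
  smooth₁ : SmoothOneForm α₁
  smooth₂ : SmoothOneForm α₂
  degree_eq : 1 + 2 * h + 1 + 2 * k = Module.finrank ℝ E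
  volume : ∀ x, contactPairForm α₁ α₂ h k x ≠ 0
  pow₁ : ∀ x, wedgePow (extD α₁ x) (h + 1) = 0
  pow₂ : ∀ x, wedgePow (extD α₂ x) (k + 1) = 0

/-- `Z₁` and `Z₂` are the Reeb vector fields of `(α₁, α₂)`: `αᵢ(Zⱼ) = δᵢⱼ` and the contractions
of `dα₁` and `dα₂` with `Z₁` and `Z₂` vanish. For a contact pair these equations
determine `Z₁` and `Z₂` uniquely. -/
structure IsReebPair (α₁ α₂ : ∀ x : M, TangentSpace 𝓘(ℝ, E) x →L[ℝ] ℝ)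
    (Z₁ Z₂ : ∀ x : M, TangentSpace 𝓘(ℝ, E) x) : Prop where
  smooth₁ : SmoothVectorField Z₁
  smooth₂ : SmoothVectorField Z₂
  apply₁₁ : ∀ x, α₁ x (Z₁ x) = 1
  apply₂₂ : ∀ x, α₂ x (Z₂ x) = 1
  apply₁₂ : ∀ x, α₁ x (Z₂ x) = 0
  apply₂₁ : ∀ x, α₂ x (Z₁ x) = 0
  contract₁₁ : ∀ x v, extD α₁ x ![Z₁ x, v] = 0
  contract₂₁ : ∀ x v, extD α₂ x ![Z₁ x, v] = 0
  contract₁₂ : ∀ x v, extD α₁ x ![Z₂ x, v] = 0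
  contract₂₂ : ∀ x v, extD α₂ x ![Z₂ x, v] = 0

/-- `φ² = -Id + α₁ ⊗ Z₁ + α₂ ⊗ Z₂` and `φ Z₁ = φ Z₂ = 0`, where `Z₁`, `Z₂` are the Reeb vector
fields. -/
structure IsStructureTensor (α₁ α₂ : ∀ x : M, TangentSpace 𝓘(ℝ, E) x →L[ℝ] ℝ)
    (φ : ∀ x : M, TangentSpace 𝓘(ℝ, E) x →L[ℝ] TangentSpace 𝓘(ℝ, E) x)
    (Z₁ Z₂ : ∀ x : M, TangentSpace 𝓘(ℝ, E) x) : Prop where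
  smooth : SmoothEndomorphism φ
  sq : ∀ x v, φ x (φ x v) = -v + α₁ x v • Z₁ x + α₂ x v • Z₂ x
  apply_reeb₁ : ∀ x, φ x (Z₁ x) = 0
  apply_reeb₂ : ∀ x, φ x (Z₂ x) = 0

/-- `g` is associated: `g(X, φY) = (dα₁ + dα₂)(X, Y)` and `g(X, Zᵢ) = αᵢ(X)`. -/
structure IsAssociated (α₁ α₂ : ∀ x : M, TangentSpace 𝓘(ℝ, E) x →L[ℝ] ℝ)
    (φ : ∀ x : M, TangentSpace 𝓘(ℝ, E) x →L[ℝ] TangentSpace 𝓘(ℝ, E) x)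
    (Z₁ Z₂ : ∀ x : M, TangentSpace 𝓘(ℝ, E) x)
    (g : ContMDiffRiemannianMetric 𝓘(ℝ, E) ∞ E (fun x : M ↦ TangentSpace 𝓘(ℝ, E) x)) :
    Prop where
  inner_apply : ∀ x v w, g.inner x v (φ x w) = extD α₁ x ![v, w] + extD α₂ x ![v, w]
  inner_reeb₁ : ∀ x v, g.inner x v (Z₁ x) = α₁ x v
  inner_reeb₂ : ∀ x v, g.inner x v (Z₂ x) = α₂ x v

/-- `(α₁, α₂, φ, g)` is a metric contact pair of type `(h, k)` on `M`. -/
def IsMetricContactPair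
    (α₁ α₂ : ∀ x : M, TangentSpace 𝓘(ℝ, E) x →L[ℝ] ℝ)
    (φ : ∀ x : M, TangentSpace 𝓘(ℝ, E) x →L[ℝ] TangentSpace 𝓘(ℝ, E) x)
    (g : ContMDiffRiemannianMetric 𝓘(ℝ, E) ∞ E (fun x : M ↦ TangentSpace 𝓘(ℝ, E) x))
    (h k : ℕ) : Prop :=
  IsContactPair α₁ α₂ h k ∧
    ∃ Z₁ Z₂ : ∀ x : M, TangentSpace 𝓘(ℝ, E) x,
      IsReebPair α₁ α₂ Z₁ Z₂ ∧ IsStructureTensor α₁ α₂ φ Z₁ Z₂ ∧ IsAssociated α₁ α₂ φ Z₁ Z₂ g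

/-- The kernel distribution of `dα`, tangent to the characteristic foliation of `dα`. -/
def kerD (α : ∀ x : M, TangentSpace 𝓘(ℝ, E) x →L[ℝ] ℝ) (x : M) :
    Submodule ℝ (TangentSpace 𝓘(ℝ, E) x) :=
  formKer (extD α x)

/-- The distribution `ker α ∩ ker dα`, tangent to the characteristic foliation of `α`. -/
def charDistribution (α : ∀ x : M, TangentSpace 𝓘(ℝ, E) x →L[ℝ] ℝ) (x : M) :
    Submodule ℝ (TangentSpace 𝓘(ℝ, E) x) :=
  LinearMap.ker (α x).toLinearMap ⊓ kerD α x

/-- `φ` is decomposable: it maps the tangent bundle of each of the characteristic foliations of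
`α₁` and `α₂` into itself. -/
def IsDecomposable (α₁ α₂ : ∀ x : M, TangentSpace 𝓘(ℝ, E) x →L[ℝ] ℝ)
    (φ : ∀ x : M, TangentSpace 𝓘(ℝ, E) x →L[ℝ] TangentSpace 𝓘(ℝ, E) x) : Prop :=
  ∀ x, (∀ v ∈ charDistribution α₁ x, φ x v ∈ charDistribution α₁ x) ∧
    (∀ v ∈ charDistribution α₂ x, φ x v ∈ charDistribution α₂ x)

end Manifold

/-! ### Leaves and induced structures -/

section Leaves

variable {E : Type*} [NormedAddCommGroup E] [NormedSpace ℝ E]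
  {M : Type*} [TopologicalSpace M] [ChartedSpace E M] [IsManifold 𝓘(ℝ, E) ∞ M]
  {F : Type*} [NormedAddCommGroup F] [NormedSpace ℝ F]
  {L : Type*} [TopologicalSpace L] [ChartedSpace F L] [IsManifold 𝓘(ℝ, F) ∞ L]

/-- `ι : L → M` is an injectively immersed connected integral manifold of the distribution `D`. -/
structure IsConnectedIntegralManifold (D : ∀ x : M, Submodule ℝ (TangentSpace 𝓘(ℝ, E) x))
    (ι : L → M) : Prop where
  connected : ConnectedSpace L
  smooth : ContMDiff 𝓘(ℝ, F) 𝓘(ℝ, E) ∞ ι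
  injective : Function.Injective ι
  immersion : ∀ p, Function.Injective (mfderiv 𝓘(ℝ, F) 𝓘(ℝ, E) ι p)
  tangent : ∀ p, LinearMap.range (mfderiv 𝓘(ℝ, F) 𝓘(ℝ, E) ι p).toLinearMap = D (ι p)

/-- `ι : L → M` is a leaf of the foliation tangent to `D`: a connected integral manifold which is
not properly contained in a larger one. -/
structure IsLeaf {L : Type u} [TopologicalSpace L] [ChartedSpace F L]
    (D : ∀ x : M, Submodule ℝ (TangentSpace 𝓘(ℝ, E) x)) (ι : L → M) : Prop
    extends IsConnectedIntegralManifold (F := F) D ι where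
  maximal : ∀ (N : Type u) [TopologicalSpace N] [ChartedSpace F N] [IsManifold 𝓘(ℝ, F) ∞ N]
    (j : N → M), IsConnectedIntegralManifold (F := F) D j → range ι ⊆ range j →
      range j ⊆ range ι

/-- The restriction (pullback) of a `1`-form to an immersed manifold `ι : L → M`. -/
def restrictForm (ι : L → M) (α : ∀ x : M, TangentSpace 𝓘(ℝ, E) x →L[ℝ] ℝ) (p : L) :
    TangentSpace 𝓘(ℝ, F) p →L[ℝ] ℝ :=
  (α (ι p)).comp (mfderiv 𝓘(ℝ, F) 𝓘(ℝ, E) ι p)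

/-- `(α₁, α₂, φ, g)` induces a metric contact pair of type `(h, k)` on the immersed manifold
`ι : L → M`: `φ` preserves the tangent spaces of `L`, and the restrictions of `α₁`, `α₂`, `φ`, `g`
to `L` form a metric contact pair of type `(h, k)`. -/
def InducesMetricContactPair (ι : L → M)
    (α₁ α₂ : ∀ x : M, TangentSpace 𝓘(ℝ, E) x →L[ℝ] ℝ)
    (φ : ∀ x : M, TangentSpace 𝓘(ℝ, E) x →L[ℝ] TangentSpace 𝓘(ℝ, E) x)
    (g : ContMDiffRiemannianMetric 𝓘(ℝ, E) ∞ E (fun x : M ↦ TangentSpace 𝓘(ℝ, E) x))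
    (h k : ℕ) : Prop :=
  ∃ (φL : ∀ p : L, TangentSpace 𝓘(ℝ, F) p →L[ℝ] TangentSpace 𝓘(ℝ, F) p)
    (gL : ContMDiffRiemannianMetric 𝓘(ℝ, F) ∞ F (fun p : L ↦ TangentSpace 𝓘(ℝ, F) p)),
    (∀ p v, mfderiv 𝓘(ℝ, F) 𝓘(ℝ, E) ι p (φL p v) =
      φ (ι p) (mfderiv 𝓘(ℝ, F) 𝓘(ℝ, E) ι p v)) ∧
    (∀ p v w, gL.inner p v w =
      g.inner (ι p) (mfderiv 𝓘(ℝ, F) 𝓘(ℝ, E) ι p v) (mfderiv 𝓘(ℝ, F) 𝓘(ℝ, E) ι p w)) ∧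
    IsMetricContactPair (restrictForm (F := F) ι α₁) (restrictForm (F := F) ι α₂) φL gL h k

end Leaves

end ContactPair

end

/-! Let `D` be the kernel of one of the two exterior derivatives, say of `dα₂`. It contains both
Reeb vectors. It is also `φ`-invariant: subtracting `α₂(v) Z₂` from a vector `v` of `D` lands in
`ker α₂ ∩ ker dα₂`, which decomposability preserves, and `φ Z₂ = 0`. So `φ`, `Z₁`, `Z₂` and `g`
restrict to an integral manifold of `D` (`IsConnectedIntegralManifold.exists_restriction`). The
algebraic identities restrict with them, because `d` commutes with pullback (`extD_restrictForm`).
The same fact gives `dα₂ = 0` and `(dα₁)^(h+1) = 0` on the leaf.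

What remains is that the leaf has dimension `2h + 2` and that the volume form there is nonzero. Both
rest on the relation between the rank of a 2-form and its powers. A form with `m` hyperbolic pairs
has nonzero `m`-th power (`IsHyperbolicFamily.wedgePow_pos`), so `(dα₁)^(h+1) = 0` and `(dα₂)^(k+1)
= 0` bound the two kernels from below by `2k + 2` and `2h + 2`. In the other direction, positivity
of `g` confines `ker dα₁ ∩ ker dα₂` to the span of the Reeb vectors (`eq_reeb_of_mem_kerD`), so both
bounds are equalities (`finrank_kerD`).

Applied on the leaf itself, where `ker dα₂` is everything, the intersection bound says that `dα₁`
has kernel of dimension at most 2. Its rank is then at least `2h`, its `h`-th power is nonzero, and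
evaluation on Reeb vectors completed by suitable vectors shows that the volume form does not vanish
(`wedge_contact_ne_zero`). The other foliation is symmetric. -/

noncomputable section

namespace ContactPair

/-! ### Powers of a 2-form and its rank. -/

section ExteriorAlgebra

variable {V W : Type*} [AddCommGroup V] [Module ℝ V] [AddCommGroup W] [Module ℝ W]

theorem wedge_apply {p q : ℕ} (a : V [⋀^Fin p]→ₗ[ℝ] ℝ) (b : V [⋀^Fin q]→ₗ[ℝ] ℝ)
    (v : Fin (p + q) → V) :
    wedge a b v = ∑ σ : Equiv.Perm.ModSumCongr (Fin p) (Fin q),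
      LinearMap.mul' ℝ ℝ (AlternatingMap.domCoprod.summand a b σ (v ∘ finSumFinEquiv)) := by
  simp only [wedge, AlternatingMap.domDomCongr_apply, LinearMap.compAlternatingMap_apply]
  rw [← AlternatingMap.coe_multilinearMap, AlternatingMap.domCoprod_coe,
    sum_apply, map_sum]

/-- If `b` vanishes on every family containing one of the first `p` vectors of `v`, then only the
trivial shuffle contributes to `(a ∧ b)(v)`. -/
theorem wedge_apply_of_vanish {p q : ℕ} (a : V [⋀^Fin p]→ₗ[ℝ] ℝ) (b : V [⋀^Fin q]→ₗ[ℝ] ℝ)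
    (v : Fin p → V) (w : Fin q → V) (hb : ∀ i u j, u j = v i → b u = 0) :
    wedge a b (Fin.append v w) = a v * b w := by
  rw [wedge_apply]
  refine (Fintype.sum_eq_single (Quotient.mk'' 1 : Equiv.Perm.ModSumCongr (Fin p) (Fin q))
    fun σ hσ ↦ ?_).trans ?_
  rotate_left
  · rw [AlternatingMap.domCoprod.summand_mk'']
    simp [MultilinearMap.domDomCongr_apply, MultilinearMap.domCoprod_apply]
  · induction σ using Quotient.inductionOn' with | _ σ
    rw [AlternatingMap.domCoprod.summand_mk'']
    -- A permutation keeping the right block in place also keeps the left block, and so represents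
    -- the trivial class. Any other shuffle feeds some `v i` to `b`.
    have hex : ∃ i j, σ (Sum.inr j) = Sum.inl i := by
      by_contra! hne
      refine hσ ?_
      symm
      rw [Quotient.eq'', QuotientGroup.leftRel_apply, inv_one, one_mul]
      apply Equiv.Perm.mem_sumCongrHom_range_of_perm_mapsTo_inl
      rw [Equiv.Perm.perm_mapsTo_inl_iff_mapsTo_inr]
      rintro _ ⟨j, rfl⟩
      rcases hj : σ (Sum.inr j) with i | j'
      · exact absurd hj (hne i j)
      · exact ⟨j', rfl⟩
    obtain ⟨i, j, hij⟩ := hex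
    have h0 := hb i (fun k ↦ Fin.append v w (finSumFinEquiv (σ (Sum.inr k)))) j (by simp [hij])
    simp [MultilinearMap.domDomCongr_apply, MultilinearMap.domCoprod_apply, h0]

theorem wedge_compLinearMap {p q : ℕ} (a : V [⋀^Fin p]→ₗ[ℝ] ℝ) (b : V [⋀^Fin q]→ₗ[ℝ] ℝ)
    (f : W →ₗ[ℝ] V) :
    wedge (a.compLinearMap f) (b.compLinearMap f) = (wedge a b).compLinearMap f := by
  ext v
  rw [AlternatingMap.compLinearMap_apply, wedge_apply, wedge_apply]
  refine Finset.sum_congr rfl fun σ _ ↦ ?_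
  induction σ using Quotient.inductionOn' with | _ σ
  simp [AlternatingMap.domCoprod.summand_mk'', MultilinearMap.domDomCongr_apply,
    MultilinearMap.domCoprod_apply, Function.comp_def]

theorem wedgePow_compLinearMap (η : V [⋀^Fin 2]→ₗ[ℝ] ℝ) (f : W →ₗ[ℝ] V) (m : ℕ) :
    wedgePow (η.compLinearMap f) m = (wedgePow η m).compLinearMap f := by
  induction m with
  | zero => ext v; simp [wedgePow]
  | succ m ih => rw [wedgePow, wedgePow, ih, wedge_compLinearMap]

theorem wedgePow_zero_form (m : ℕ) : wedgePow (0 : V [⋀^Fin 2]→ₗ[ℝ] ℝ) (m + 1) = 0 := by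
  ext v
  rw [wedgePow, wedge_apply]
  refine Finset.sum_eq_zero fun σ _ ↦ ?_
  induction σ using Quotient.inductionOn' with | _ σ
  simp [AlternatingMap.domCoprod.summand_mk'', MultilinearMap.domDomCongr_apply,
    MultilinearMap.domCoprod_apply]

theorem wedge_alternatization {p q : ℕ} (a : MultilinearMap ℝ (fun _ : Fin p ↦ V) ℝ)
    (b : MultilinearMap ℝ (fun _ : Fin q ↦ V) ℝ) :
    wedge (MultilinearMap.alternatization a) (MultilinearMap.alternatization b) =
      MultilinearMap.alternatization
        (((LinearMap.mul' ℝ ℝ).compMultilinearMap (a.domCoprod b)).domDomCongr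
          finSumFinEquiv) := by
  rw [wedge, ← MultilinearMap.domCoprod_alternization,
    ← LinearMap.compMultilinearMap_alternatization]
  ext v
  rw [AlternatingMap.domDomCongr_apply, MultilinearMap.alternatization_apply,
    MultilinearMap.alternatization_apply]
  refine Fintype.sum_equiv (Equiv.permCongr finSumFinEquiv) _ _ fun σ ↦ ?_
  simp [MultilinearMap.domDomCongr_apply, Equiv.Perm.sign_permCongr, MultilinearMap.domCoprod_apply]

/-- The multilinear form `(v₀, …, v₂ₘ₋₁) ↦ η(v₀, v₁) η(v₂, v₃) ⋯`. -/
def pairProd (η : V [⋀^Fin 2]→ₗ[ℝ] ℝ) : (m : ℕ) → MultilinearMap ℝ (fun _ : Fin (2 * m) ↦ V) ℝ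
  | 0 => MultilinearMap.constOfIsEmpty ℝ (fun _ : Fin 0 ↦ V) 1
  | m + 1 => ((LinearMap.mul' ℝ ℝ).compMultilinearMap
      ((pairProd η m).domCoprod (η : MultilinearMap ℝ (fun _ : Fin 2 ↦ V) ℝ))).domDomCongr
        (finSumFinEquiv (m := 2 * m) (n := 2))

theorem pairProd_apply (η : V [⋀^Fin 2]→ₗ[ℝ] ℝ) (m : ℕ) (v : Fin (2 * m) → V) :
    pairProd η m v =
      ∏ i : Fin m, η ![v ⟨2 * i, by omega⟩, v ⟨2 * i + 1, by omega⟩] := by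
  induction m with
  | zero => simp [pairProd]
  | succ m ih =>
    rw [pairProd, MultilinearMap.domDomCongr_apply, LinearMap.compMultilinearMap_apply,
      MultilinearMap.domCoprod_apply, LinearMap.mul'_apply, ih, Fin.prod_univ_castSucc]
    congr 1
    rw [AlternatingMap.coe_multilinearMap]
    congr 1
    ext j
    fin_cases j <;> rfl

/-- Wedges sum over shuffles, alternatization over all permutations. Each factor `η` is already
alternating, so it is counted `2! = 2` times. This turns powers of `η` into explicit sums of
products of pairings. -/
theorem smul_wedgePow (η : V [⋀^Fin 2]→ₗ[ℝ] ℝ) (m : ℕ) :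
    (2 : ℝ) ^ m • wedgePow η m = MultilinearMap.alternatization (pairProd η m) := by
  induction m with
  | zero =>
    ext v
    rw [MultilinearMap.alternatization_apply]
    simp [wedgePow, pairProd]
  | succ m ih =>
    have h2 : MultilinearMap.alternatization (η : MultilinearMap ℝ (fun _ : Fin 2 ↦ V) ℝ) =
        (2 : ℝ) • η := by
      rw [AlternatingMap.coe_alternatization]
      ext v
      simp
    have h := wedge_alternatization (pairProd η m) (η : MultilinearMap ℝ (fun _ : Fin 2 ↦ V) ℝ)
    rw [← ih, h2] at h
    rw [pairProd]
    refine Eq.trans ?_ h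
    ext v
    rw [AlternatingMap.smul_apply, wedgePow, wedge_apply, wedge_apply, smul_eq_mul,
      Finset.mul_sum]
    refine Finset.sum_congr rfl fun σ _ ↦ ?_
    induction σ using Quotient.inductionOn' with | _ σ
    simp [AlternatingMap.domCoprod.summand_mk'', MultilinearMap.domDomCongr_apply,
      MultilinearMap.domCoprod_apply, pow_succ, Units.smul_def, ← Int.cast_smul_eq_zsmul ℝ]
    ring

/-- A family of pairs of vectors which is hyperbolic for `η`: different pairs are orthogonal and
`η` takes the value `1` on each pair. -/
structure IsHyperbolicFamily (η : V [⋀^Fin 2]→ₗ[ℝ] ℝ) {m : ℕ} (w : Fin m × Fin 2 → V) :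
    Prop where
  pair : ∀ i, η ![w (i, 0), w (i, 1)] = 1
  orthogonal : ∀ p q, p.1 ≠ q.1 → η ![w p, w q] = 0

theorem apply_swap (η : V [⋀^Fin 2]→ₗ[ℝ] ℝ) (x y : V) : η ![y, x] = -η ![x, y] := by
  have h := η.map_swap ![x, y] (i := 0) (j := 1) (by decide)
  rw [← h]
  congr 1
  ext j
  fin_cases j <;> rfl

theorem apply_self (η : V [⋀^Fin 2]→ₗ[ℝ] ℝ) (x : V) : η ![x, x] = 0 :=
  η.map_eq_zero_of_eq _ (i := 0) (j := 1) rfl (by decide)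

theorem IsHyperbolicFamily.apply_perm {η : V [⋀^Fin 2]→ₗ[ℝ] ℝ} {m : ℕ}
    {w : Fin m × Fin 2 → V} (hw : IsHyperbolicFamily η w) (i : Fin m) (ε : Equiv.Perm (Fin 2)) :
    ((Equiv.Perm.sign ε : ℤ) : ℝ) * η ![w (i, ε 0), w (i, ε 1)] = 1 := by
  have hε : ε = 1 ∨ ε = Equiv.swap 0 1 := by
    revert ε; decide
  rcases hε with rfl | rfl
  · simp [hw.pair]
  · simp [apply_swap η (w (i, 0)), hw.pair]

/-- No cancellation can occur: a permutation that breaks up a pair contributes `0` by orthogonality,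
and one that permutes pairs and flips some of them contributes `1`, each flip changing both the sign
and one factor. -/
theorem IsHyperbolicFamily.sign_mul_prod_nonneg {η : V [⋀^Fin 2]→ₗ[ℝ] ℝ} {m : ℕ}
    {w : Fin m × Fin 2 → V} (hw : IsHyperbolicFamily η w) (σ : Equiv.Perm (Fin m × Fin 2)) :
    0 ≤ ((Equiv.Perm.sign σ : ℤ) : ℝ) * ∏ i, η ![w (σ (i, 0)), w (σ (i, 1))] := by
  by_cases h : ∃ i, (σ (i, 0)).1 ≠ (σ (i, 1)).1
  · obtain ⟨i, hi⟩ := h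
    rw [Finset.prod_eq_zero (Finset.mem_univ i) (hw.orthogonal _ _ hi), mul_zero]
  · push Not at h
    have hj : ∀ i j, (σ (i, j)).1 = (σ (i, 0)).1 := by
      intro i j
      fin_cases j
      · rfl
      · exact (h i).symm
    have hsurj : Function.Surjective fun i ↦ (σ (i, 0)).1 := by
      intro k
      refine ⟨(σ.symm (k, 0)).1, ?_⟩
      have := hj (σ.symm (k, 0)).1 (σ.symm (k, 0)).2
      simpa using this.symm
    let ρ : Equiv.Perm (Fin m) :=
      Equiv.ofBijective _ (Finite.injective_iff_bijective.1 (Finite.injective_iff_surjective.2 hsurj))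
    have hinj : ∀ i, Function.Injective fun j ↦ (σ (i, j)).2 := by
      intro i j j' hjj
      have : σ (i, j) = σ (i, j') := Prod.ext ((hj i j).trans (hj i j').symm) hjj
      simpa using this
    let ε : Fin m → Equiv.Perm (Fin 2) := fun i ↦
      Equiv.ofBijective _ (Finite.injective_iff_bijective.1 (hinj i))
    have hσ : σ = Equiv.prodCongrLeft (fun _ ↦ ρ) * Equiv.prodCongrRight ε := by
      ext1 ⟨i, j⟩
      exact Prod.ext (hj i j) rfl
    -- Permuting whole pairs by `ρ` acts identically on two copies of `Fin m`, so its sign is a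
    -- square.
    have hs : Equiv.Perm.sign σ = ∏ i, Equiv.Perm.sign (ε i) := by
      rw [hσ, Equiv.Perm.sign_mul, Equiv.Perm.sign_prodCongrLeft, Equiv.Perm.sign_prodCongrRight]
      simp
    have hv : ∀ i j, σ (i, j) = (ρ i, ε i j) := fun i j ↦ Prod.ext (hj i j) rfl
    have : ((Equiv.Perm.sign σ : ℤ) : ℝ) * ∏ i, η ![w (σ (i, 0)), w (σ (i, 1))] = 1 := by
      rw [hs]
      push_cast
      rw [← Finset.prod_mul_distrib]
      exact Finset.prod_eq_one fun i _ ↦ by rw [hv, hv]; exact hw.apply_perm _ _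
    rw [this]
    exact zero_le_one

/-- The bijection `(i, j) ↦ 2 i + j`. -/
def pairEquiv (m : ℕ) : Fin m × Fin 2 ≃ Fin (2 * m) :=
  finProdFinEquiv.trans (finCongr (mul_comm m 2))

theorem IsHyperbolicFamily.wedgePow_pos {η : V [⋀^Fin 2]→ₗ[ℝ] ℝ} {m : ℕ}
    {w : Fin m × Fin 2 → V} (hw : IsHyperbolicFamily η w) :
    0 < wedgePow η m (w ∘ (pairEquiv m).symm) := by
  have h := congrArg (fun f ↦ f (w ∘ (pairEquiv m).symm)) (smul_wedgePow η m)
  simp only [AlternatingMap.smul_apply, MultilinearMap.alternatization_apply, smul_eq_mul] at h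
  have hsum : ∑ σ : Equiv.Perm (Fin (2 * m)), Equiv.Perm.sign σ •
      (pairProd η m).domDomCongr σ (w ∘ (pairEquiv m).symm) =
      ∑ σ : Equiv.Perm (Fin m × Fin 2),
        ((Equiv.Perm.sign σ : ℤ) : ℝ) * ∏ i, η ![w (σ (i, 0)), w (σ (i, 1))] := by
    symm
    refine Fintype.sum_equiv (Equiv.permCongr (pairEquiv m)) _ _ fun σ ↦ ?_
    have h0 : ∀ i : Fin m, (pairEquiv m).symm ⟨2 * i, by omega⟩ = (i, 0) := by
      intro i
      rw [Equiv.symm_apply_eq]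
      ext
      simp [pairEquiv]
    have h1 : ∀ i : Fin m, (pairEquiv m).symm ⟨2 * i + 1, by omega⟩ = (i, 1) := by
      intro i
      rw [Equiv.symm_apply_eq]
      ext
      simp [pairEquiv, add_comm]
    rw [Equiv.Perm.sign_permCongr, MultilinearMap.domDomCongr_apply, pairProd_apply,
      Units.smul_def, ← Int.cast_smul_eq_zsmul ℝ, smul_eq_mul]
    simp [Equiv.permCongr_apply, h0, h1]
  rw [hsum] at h
  have hpos : 0 < ∑ σ : Equiv.Perm (Fin m × Fin 2),
      ((Equiv.Perm.sign σ : ℤ) : ℝ) * ∏ i, η ![w (σ (i, 0)), w (σ (i, 1))] := by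
    refine Finset.sum_pos' (fun σ _ ↦ hw.sign_mul_prod_nonneg σ) ⟨1, Finset.mem_univ _, ?_⟩
    simp [hw.pair]
  rw [← h] at hpos
  exact pos_of_mul_pos_right hpos (by positivity)

/-- A `2`-form as a bilinear map. -/
def toBilin (η : V [⋀^Fin 2]→ₗ[ℝ] ℝ) : V →ₗ[ℝ] V →ₗ[ℝ] ℝ :=
  LinearMap.mk₂ ℝ (fun x y ↦ η ![x, y])
    (fun x x' y ↦ η.map_vecCons_add ![y] x x')
    (fun c x y ↦ η.map_vecCons_smul ![y] c x)
    (fun x y y' ↦ by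
      rw [apply_swap, η.map_vecCons_add ![x] y y', apply_swap η x y, apply_swap η x y']
      ring)
    (fun c x y ↦ by
      rw [apply_swap, η.map_vecCons_smul ![x] c y, apply_swap η x y]
      simp)

@[simp]
theorem toBilin_apply (η : V [⋀^Fin 2]→ₗ[ℝ] ℝ) (x y : V) : toBilin η x y = η ![x, y] := rfl

theorem mem_formKer {η : V [⋀^Fin 2]→ₗ[ℝ] ℝ} {v : V} : v ∈ formKer η ↔ ∀ w, η ![v, w] = 0 :=
  Iff.rfl

/-- Symplectic Gram–Schmidt. The hypothesis says that the rank exceeds `2m - 2`; asking for no more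
than this avoids having to know that the rank is even. -/
theorem exists_isHyperbolicFamily [FiniteDimensional ℝ V] (η : V [⋀^Fin 2]→ₗ[ℝ] ℝ) (m : ℕ)
    (h : Module.finrank ℝ (formKer η) + 2 * m < Module.finrank ℝ V + 2) :
    ∃ w : Fin m × Fin 2 → V, IsHyperbolicFamily η w := by
  induction m with
  | zero => exact ⟨fun p ↦ p.1.elim0, fun i ↦ i.elim0, fun p ↦ p.1.elim0⟩
  | succ m ih =>
    obtain ⟨w, hw⟩ := ih (by omega)
    let P : V →ₗ[ℝ] (Fin m × Fin 2 → ℝ) := LinearMap.pi fun p ↦ toBilin η (w p)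
    -- The `η`-orthogonal complement of the `2m` vectors found so far has codimension at most `2m`,
    -- hence is too large to lie in the kernel of `η`.
    have hP : ¬ LinearMap.ker P ≤ formKer η := by
      intro hle
      have h1 := Submodule.finrank_mono hle
      have h2 := P.finrank_range_add_finrank_ker
      have h3 := (LinearMap.range P).finrank_le
      simp at h3
      omega
    obtain ⟨x, hxP, hx⟩ := SetLike.not_le_iff_exists.1 hP
    have hxw : ∀ p, η ![w p, x] = 0 := fun p ↦ congrFun hxP p
    rw [mem_formKer] at hx
    push Not at hx
    obtain ⟨u, hu⟩ := hx
    -- Subtracting the `η`-projection to the span of the old pairs makes `u'` orthogonal to them;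
    -- its pairing with `x` is unchanged because `x` is orthogonal to them as well.
    let u' : V := u - ∑ i, (toBilin η u (w (i, 1)) • w (i, 0) - toBilin η u (w (i, 0)) • w (i, 1))
    have hsum : ∀ y, η ![u', y] = η ![u, y] - ∑ i, (η ![u, w (i, 1)] * η ![w (i, 0), y] -
        η ![u, w (i, 0)] * η ![w (i, 1), y]) := by
      intro y
      rw [← toBilin_apply]
      simp only [u', map_sub, map_sum, LinearMap.sub_apply, LinearMap.sum_apply, map_smul,
        LinearMap.smul_apply, toBilin_apply, smul_eq_mul]
    have hu'w : ∀ p, η ![u', w p] = 0 := by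
      rintro ⟨k, j⟩
      rw [hsum, Fintype.sum_eq_single k]
      · fin_cases j
        · have := hw.pair k
          simp [apply_self, apply_swap η (w (k, 0)) (w (k, 1)), this]
        · have := hw.pair k
          simp [apply_self, this]
      · intro i hi
        rw [hw.orthogonal (i, 0) (k, j) hi, hw.orthogonal (i, 1) (k, j) hi]
        simp
    have hxu' : η ![u', x] = η ![u, x] := by
      rw [hsum]
      simp [hxw]
    have hc : η ![x, u'] ≠ 0 := by
      rwa [apply_swap, hxu', ← apply_swap]
    let y : V := (η ![x, u'])⁻¹ • u'
    have hy : ∀ z, η ![z, y] = (η ![x, u'])⁻¹ * η ![z, u'] := by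
      intro z
      rw [← toBilin_apply]
      simp [y]
    let w' : Fin (m + 1) × Fin 2 → V := fun p ↦
      Fin.lastCases (motive := fun _ ↦ V) (![x, y] p.2) (fun i ↦ w (i, p.2)) p.1
    have hwx : ∀ p (j : Fin 2), η ![w p, ![x, y] j] = 0 := by
      intro p j
      fin_cases j
      · exact hxw p
      · change η ![w p, y] = 0
        rw [hy, apply_swap η u' (w p), hu'w]
        simp
    refine ⟨w', ?_, ?_⟩
    · intro i
      induction i using Fin.lastCases with
      | last => simp [w', hy, hc]
      | cast i => simp [w', hw.pair]
    · rintro ⟨i, j⟩ ⟨i', j'⟩ hne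
      induction i using Fin.lastCases with
      | last =>
        induction i' using Fin.lastCases with
        | last => exact absurd rfl hne
        | cast i' =>
          simp only [w', Fin.lastCases_last, Fin.lastCases_castSucc]
          rw [apply_swap, hwx, neg_zero]
      | cast i =>
        induction i' using Fin.lastCases with
        | last =>
          simp only [w', Fin.lastCases_last, Fin.lastCases_castSucc]
          exact hwx _ _
        | cast i' =>
          simp only [w', Fin.lastCases_castSucc]
          exact hw.orthogonal _ _ fun h ↦ hne (congrArg Fin.castSucc h)

/-- If `η ^ (k + 1) = 0` then `η` has rank at most `2 k`. -/
theorem finrank_le_of_wedgePow_eq_zero [FiniteDimensional ℝ V] {η : V [⋀^Fin 2]→ₗ[ℝ] ℝ} {k : ℕ}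
    (h : wedgePow η (k + 1) = 0) :
    Module.finrank ℝ V ≤ Module.finrank ℝ (formKer η) + 2 * k := by
  by_contra! hlt
  obtain ⟨w, hw⟩ := exists_isHyperbolicFamily η (k + 1) (by omega)
  have := hw.wedgePow_pos
  simp [h] at this

/-- A `2`-form of rank at least `2 h` has nonzero `h`-th power, also on vectors in the kernel of a
linear form which is nonzero on the kernel of the `2`-form. -/
theorem exists_wedgePow_ne_zero [FiniteDimensional ℝ V] {η : V [⋀^Fin 2]→ₗ[ℝ] ℝ} {h : ℕ}
    (hη : Module.finrank ℝ (formKer η) + 2 * h ≤ Module.finrank ℝ V)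
    (a : V →ₗ[ℝ] ℝ) {Z : V} (hZ : ∀ v, η ![Z, v] = 0) (ha : a Z = 1) :
    ∃ x : Fin (2 * h) → V, (∀ i, a (x i) = 0) ∧ wedgePow η h x ≠ 0 := by
  obtain ⟨w, hw⟩ := exists_isHyperbolicFamily η h (by omega)
  have hZ' : ∀ v, η ![v, Z] = 0 := fun v ↦ by rw [apply_swap, hZ, neg_zero]
  -- Since `Z` is in the kernel of `η` and `a Z = 1`, a hyperbolic family can be moved into `ker a`
  -- along `Z` without changing any pairing.
  have hmod : ∀ v v', η ![v - a v • Z, v' - a v' • Z] = η ![v, v'] := by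
    intro v v'
    rw [← toBilin_apply]
    simp only [map_sub, map_smul, LinearMap.sub_apply, LinearMap.smul_apply, toBilin_apply, hZ,
      hZ', smul_eq_mul]
    ring
  have hw' : IsHyperbolicFamily η fun p ↦ w p - a (w p) • Z :=
    ⟨fun i ↦ by rw [hmod, hw.pair], fun p q hpq ↦ by rw [hmod, hw.orthogonal p q hpq]⟩
  exact ⟨_, fun i ↦ by simp [ha], hw'.wedgePow_pos.ne'⟩

/-- In the expanded power, every product of pairings has one factor involving `u j`, and that factor
is zero. -/
theorem wedgePow_eq_zero_of_mem_formKer {η : V [⋀^Fin 2]→ₗ[ℝ] ℝ} (m : ℕ)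
    (u : Fin (2 * m) → V) (j : Fin (2 * m)) (hj : u j ∈ formKer η) : wedgePow η m u = 0 := by
  have h := congrArg (fun f ↦ f u) (smul_wedgePow η m)
  simp only [AlternatingMap.smul_apply, MultilinearMap.alternatization_apply, smul_eq_mul] at h
  rw [Finset.sum_eq_zero] at h
  · exact (mul_eq_zero.1 h).resolve_left (by positivity)
  · intro σ _
    rw [MultilinearMap.domDomCongr_apply, pairProd_apply]
    obtain ⟨⟨i, l⟩, hil⟩ := (pairEquiv m).surjective (σ.symm j)
    rw [Finset.prod_eq_zero (Finset.mem_univ i), smul_zero]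
    have hj' : u (σ (pairEquiv m (i, l))) ∈ formKer η := by rwa [hil, Equiv.apply_symm_apply]
    fin_cases l
    · have : pairEquiv m (i, 0) = ⟨2 * i, by omega⟩ := by ext; simp [pairEquiv]
      rw [← this]
      exact hj' _
    · have : pairEquiv m (i, 1) = ⟨2 * i + 1, by omega⟩ := by ext; simp [pairEquiv, add_comm]
      rw [← this, apply_swap, neg_eq_zero]
      exact hj' _

/-- The pointwise volume condition of a contact pair, from Reeb vectors and vectors on which the
powers of the two `2`-forms do not vanish. -/
theorem wedge_contact_ne_zero (a₁ a₂ : V →ₗ[ℝ] ℝ) (η₁ η₂ : V [⋀^Fin 2]→ₗ[ℝ] ℝ) {h k : ℕ}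
    {Z₁ Z₂ : V} (h₁₁ : a₁ Z₁ = 1) (h₂₂ : a₂ Z₂ = 1) (h₂₁ : a₂ Z₁ = 0)
    (hc₁₁ : Z₁ ∈ formKer η₁) (hc₂₁ : Z₁ ∈ formKer η₂) (hc₂₂ : Z₂ ∈ formKer η₂)
    (x : Fin (2 * h) → V) (y : Fin (2 * k) → V) (hx : wedgePow η₁ h x ≠ 0)
    (hy : wedgePow η₂ k y ≠ 0) (hxa : ∀ i, a₂ (x i) = 0) (hxη : ∀ i, x i ∈ formKer η₂) :
    wedge (wedge (wedge (ofCovector a₁) (wedgePow η₁ h)) (ofCovector a₂)) (wedgePow η₂ k) ≠ 0 := by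
  intro h0
  have hval : wedge (wedge (wedge (ofCovector a₁) (wedgePow η₁ h)) (ofCovector a₂)) (wedgePow η₂ k)
      (Fin.append (Fin.append (Fin.append (fun _ : Fin 1 ↦ Z₁) x) (fun _ : Fin 1 ↦ Z₂)) y) =
      wedgePow η₁ h x * wedgePow η₂ k y := by
    -- On `(Z₁, x, Z₂, y)` each wedge reduces to its trivial shuffle: `η₂ ^ k` is killed by `Z₁`,
    -- `x` and `Z₂`, the covector `a₂` by `Z₁` and `x`, and `η₁ ^ h` by `Z₁`.
    rw [wedge_apply_of_vanish, wedge_apply_of_vanish, wedge_apply_of_vanish]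
    · simp [ofCovector, h₁₁, h₂₂]
    · intro _ u j hu
      exact wedgePow_eq_zero_of_mem_formKer h u j (hu ▸ hc₁₁)
    · intro i u j hu
      have : u 0 = u j := by rw [Subsingleton.elim j 0]
      simp only [ofCovector, AlternatingMap.ofSubsingleton_apply_apply]
      rw [this, hu]
      induction i using Fin.addCases with
      | left i => simp [h₂₁]
      | right i => simp [hxa]
    · intro i u j hu
      refine wedgePow_eq_zero_of_mem_formKer k u j ?_
      rw [hu]
      induction i using Fin.addCases with
      | left i =>
        rw [Fin.append_left]
        induction i using Fin.addCases with
        | left i => simpa using hc₂₁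
        | right i => simpa using hxη i
      | right i => simpa using hc₂₂
  rw [h0] at hval
  exact mul_ne_zero hx hy (by simpa using hval.symm)

end ExteriorAlgebra

/-! ### Kernels of the exterior derivatives: dimension, invariance, volume. -/

section Fibre

theorem finrank_tangentSpace {E : Type*} [NormedAddCommGroup E] [NormedSpace ℝ E]
    {M : Type*} [TopologicalSpace M] [ChartedSpace E M] (x : M) :
    Module.finrank ℝ (TangentSpace 𝓘(ℝ, E) x) = Module.finrank ℝ E := rfl

instance {E : Type*} [NormedAddCommGroup E] [NormedSpace ℝ E] [FiniteDimensional ℝ E]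
    {M : Type*} [TopologicalSpace M] [ChartedSpace E M] (x : M) :
    FiniteDimensional ℝ (TangentSpace 𝓘(ℝ, E) x) :=
  inferInstanceAs (FiniteDimensional ℝ E)

variable {E : Type*} [NormedAddCommGroup E] [NormedSpace ℝ E]
  {M : Type*} [TopologicalSpace M] [ChartedSpace E M] [IsManifold 𝓘(ℝ, E) ∞ M]
  {α₁ α₂ : ∀ x : M, TangentSpace 𝓘(ℝ, E) x →L[ℝ] ℝ}
  {φ : ∀ x : M, TangentSpace 𝓘(ℝ, E) x →L[ℝ] TangentSpace 𝓘(ℝ, E) x}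
  {Z₁ Z₂ : ∀ x : M, TangentSpace 𝓘(ℝ, E) x}
  {g : ContMDiffRiemannianMetric 𝓘(ℝ, E) ∞ E (fun x : M ↦ TangentSpace 𝓘(ℝ, E) x)}

/-- The kernels of `dα₁` and `dα₂` intersect in the span of the Reeb vectors. -/
theorem eq_reeb_of_mem_kerD (hR : IsReebPair α₁ α₂ Z₁ Z₂)
    (hS : IsStructureTensor α₁ α₂ φ Z₁ Z₂) (hA : IsAssociated α₁ α₂ φ Z₁ Z₂ g) (x : M)
    {v : TangentSpace 𝓘(ℝ, E) x} (h₁ : v ∈ kerD α₁ x) (h₂ : v ∈ kerD α₂ x) :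
    v = α₁ x v • Z₁ x + α₂ x v • Z₂ x := by
  by_contra hne
  set u := v - (α₁ x v • Z₁ x + α₂ x v • Z₂ x) with hu
  have hu0 : u ≠ 0 := sub_ne_zero.2 hne
  have hu₁ : u ∈ kerD α₁ x := Submodule.sub_mem _ h₁ <| Submodule.add_mem _
    (Submodule.smul_mem _ _ (hR.contract₁₁ x)) (Submodule.smul_mem _ _ (hR.contract₁₂ x))
  have hu₂ : u ∈ kerD α₂ x := Submodule.sub_mem _ h₂ <| Submodule.add_mem _
    (Submodule.smul_mem _ _ (hR.contract₂₁ x)) (Submodule.smul_mem _ _ (hR.contract₂₂ x))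
  have ha₁ : α₁ x u = 0 := by simp [hu, hR.apply₁₁, hR.apply₁₂]
  have ha₂ : α₂ x u = 0 := by simp [hu, hR.apply₂₁, hR.apply₂₂]
  -- The part `u` without Reeb components satisfies `φ² u = -u`, so this identity reads `-g(u, u) =
  -- dα₁(u, φu) + dα₂(u, φu) = 0`.
  have h := hA.inner_apply x u (φ x u)
  rw [hu₁, hu₂, hS.sq, ha₁, ha₂] at h
  have hpos := g.pos x u hu0
  simp at h
  exact hpos.ne' h

theorem finrank_kerD_inf_le_two [FiniteDimensional ℝ E] (hR : IsReebPair α₁ α₂ Z₁ Z₂)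
    (hS : IsStructureTensor α₁ α₂ φ Z₁ Z₂) (hA : IsAssociated α₁ α₂ φ Z₁ Z₂ g) (x : M) :
    Module.finrank ℝ ↥(kerD α₁ x ⊓ kerD α₂ x) ≤ 2 := by
  have hle : kerD α₁ x ⊓ kerD α₂ x ≤ Submodule.span ℝ (Set.range ![Z₁ x, Z₂ x]) := by
    rintro v ⟨h₁, h₂⟩
    rw [eq_reeb_of_mem_kerD hR hS hA x h₁ h₂]
    exact Submodule.add_mem _ (Submodule.smul_mem _ _ (Submodule.subset_span ⟨0, rfl⟩))
      (Submodule.smul_mem _ _ (Submodule.subset_span ⟨1, rfl⟩))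
  refine (Submodule.finrank_mono hle).trans ?_
  exact (finrank_range_le_card (R := ℝ) ![Z₁ x, Z₂ x]).trans (by simp)

/-- The characteristic foliations of `dα₁` and `dα₂` have dimensions `2 k + 2` and `2 h + 2`. -/
theorem finrank_kerD [FiniteDimensional ℝ E] {h k : ℕ} (hC : IsContactPair α₁ α₂ h k)
    (hR : IsReebPair α₁ α₂ Z₁ Z₂)
    (hS : IsStructureTensor α₁ α₂ φ Z₁ Z₂) (hA : IsAssociated α₁ α₂ φ Z₁ Z₂ g) (x : M) :
    Module.finrank ℝ (kerD α₁ x) = 2 * k + 2 ∧ Module.finrank ℝ (kerD α₂ x) = 2 * h + 2 := by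
  have h₁ := finrank_le_of_wedgePow_eq_zero (hC.pow₁ x)
  have h₂ := finrank_le_of_wedgePow_eq_zero (hC.pow₂ x)
  have h₃ := finrank_kerD_inf_le_two hR hS hA x
  have h₄ := Submodule.finrank_sup_add_finrank_inf_eq (kerD α₁ x) (kerD α₂ x)
  have h₅ := (kerD α₁ x ⊔ kerD α₂ x).finrank_le
  have h₆ := hC.degree_eq
  rw [finrank_tangentSpace] at h₁ h₂ h₅
  change _ ≤ Module.finrank ℝ (kerD α₁ x) + _ at h₁
  change _ ≤ Module.finrank ℝ (kerD α₂ x) + _ at h₂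
  -- The lower bounds `2k + 2` and `2h + 2` add up to `dim + 2`, while the sum and the intersection
  -- of the kernels allow at most `dim + 2`.
  omega

/-- Each `ker dαᵢ` is `ker αᵢ ∩ ker dαᵢ` plus the line of `Zᵢ`, and `φ` kills that line. -/
theorem map_mem_kerD_of_decomposable (hφ : IsDecomposable α₁ α₂ φ) (hR : IsReebPair α₁ α₂ Z₁ Z₂)
    (hS : IsStructureTensor α₁ α₂ φ Z₁ Z₂) (x : M) :
    (∀ v ∈ kerD α₁ x, φ x v ∈ kerD α₁ x) ∧ (∀ v ∈ kerD α₂ x, φ x v ∈ kerD α₂ x) := by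
  constructor
  · intro v hv
    have hm : v - α₁ x v • Z₁ x ∈ charDistribution α₁ x :=
      ⟨by simp [hR.apply₁₁],
        Submodule.sub_mem _ hv (Submodule.smul_mem _ _ (hR.contract₁₁ x))⟩
    have := ((hφ x).1 _ hm).2
    simpa [hS.apply_reeb₁] using this
  · intro v hv
    have hm : v - α₂ x v • Z₂ x ∈ charDistribution α₂ x :=
      ⟨by simp [hR.apply₂₂],
        Submodule.sub_mem _ hv (Submodule.smul_mem _ _ (hR.contract₂₂ x))⟩
    have := ((hφ x).2 _ hm).2
    simpa [hS.apply_reeb₂] using this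

/-- A metric almost contact structure in which `dα₂ = 0` is a contact pair of type `(h, 0)`. -/
theorem isContactPair_of_extD_right_eq_zero [FiniteDimensional ℝ E] {h : ℕ}
    (h₁ : SmoothOneForm α₁) (h₂ : SmoothOneForm α₂) (hdim : Module.finrank ℝ E = 2 * h + 2)
    (hR : IsReebPair α₁ α₂ Z₁ Z₂) (hS : IsStructureTensor α₁ α₂ φ Z₁ Z₂)
    (hA : IsAssociated α₁ α₂ φ Z₁ Z₂ g) (hpow : ∀ x, wedgePow (extD α₁ x) (h + 1) = 0)
    (hd : ∀ x, extD α₂ x = 0) : IsContactPair α₁ α₂ h 0 where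
  smooth₁ := h₁
  smooth₂ := h₂
  degree_eq := by omega
  pow₁ := hpow
  pow₂ x := by rw [hd, wedgePow_zero_form]
  volume x := by
    have hker : ∀ v, v ∈ kerD α₂ x := fun v w ↦ by rw [hd]; rfl
    have hfr := finrank_kerD_inf_le_two hR hS hA x
    rw [inf_eq_left.2 fun v _ ↦ hker v] at hfr
    obtain ⟨y, hya, hy⟩ := exists_wedgePow_ne_zero (η := extD α₁ x) (h := h)
      (by rw [finrank_tangentSpace, hdim]
          change Module.finrank ℝ (kerD α₁ x) + _ ≤ _
          omega)
      (α₂ x).toLinearMap (hR.contract₁₂ x) (hR.apply₂₂ x)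
    exact wedge_contact_ne_zero _ _ _ _ (hR.apply₁₁ x) (hR.apply₂₂ x) (hR.apply₂₁ x)
      (hR.contract₁₁ x) (hR.contract₂₁ x) (hR.contract₂₂ x) y Fin.elim0 hy
      (by simp [wedgePow]) hya fun _ ↦ hker _

/-- A metric almost contact structure in which `dα₁ = 0` is a contact pair of type `(0, k)`. -/
theorem isContactPair_of_extD_left_eq_zero [FiniteDimensional ℝ E] {k : ℕ}
    (h₁ : SmoothOneForm α₁) (h₂ : SmoothOneForm α₂) (hdim : Module.finrank ℝ E = 2 * k + 2)
    (hR : IsReebPair α₁ α₂ Z₁ Z₂) (hS : IsStructureTensor α₁ α₂ φ Z₁ Z₂)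
    (hA : IsAssociated α₁ α₂ φ Z₁ Z₂ g) (hpow : ∀ x, wedgePow (extD α₂ x) (k + 1) = 0)
    (hd : ∀ x, extD α₁ x = 0) : IsContactPair α₁ α₂ 0 k where
  smooth₁ := h₁
  smooth₂ := h₂
  degree_eq := by omega
  pow₁ x := by rw [hd, wedgePow_zero_form]
  pow₂ := hpow
  volume x := by
    have hker : ∀ v, v ∈ kerD α₁ x := fun v w ↦ by rw [hd]; rfl
    have hfr := finrank_kerD_inf_le_two hR hS hA x
    rw [inf_eq_right.2 fun v _ ↦ hker v] at hfr
    obtain ⟨y, -, hy⟩ := exists_wedgePow_ne_zero (η := extD α₂ x) (h := k)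
      (by rw [finrank_tangentSpace, hdim]
          change Module.finrank ℝ (kerD α₂ x) + _ ≤ _
          omega)
      -- The covector only serves to apply the lemma: with `h = 0` the family `x` is empty and `y`
      -- need not lie in any kernel.
      (α₂ x).toLinearMap (hR.contract₂₂ x) (hR.apply₂₂ x)
    exact wedge_contact_ne_zero _ _ _ _ (hR.apply₁₁ x) (hR.apply₂₂ x) (hR.apply₂₁ x)
      (hR.contract₁₁ x) (hR.contract₂₁ x) (hR.contract₂₂ x) Fin.elim0 y
      (by simp [wedgePow]) hy (fun i ↦ i.elim0) fun i ↦ i.elim0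

end Fibre

/-! ### Smoothness of tensor fields in local trivializations. -/

section Coordinates

variable {E : Type*} [NormedAddCommGroup E] [NormedSpace ℝ E]
  {M : Type*} [TopologicalSpace M] [ChartedSpace E M] [IsManifold 𝓘(ℝ, E) ∞ M]

variable (E) in
/-- The tangent vectors at `x` read in the trivialization of the tangent bundle at `x₀`. -/
def toModel (x₀ x : M) : TangentSpace 𝓘(ℝ, E) x →L[ℝ] E :=
  (trivializationAt E (TangentSpace 𝓘(ℝ, E)) x₀).continuousLinearMapAt ℝ x

variable (E) in
/-- The inverse of `toModel`. -/
def ofModel (x₀ x : M) : E →L[ℝ] TangentSpace 𝓘(ℝ, E) x :=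
  (trivializationAt E (TangentSpace 𝓘(ℝ, E)) x₀).symmL ℝ x

variable (E) in
theorem eventually_mem_baseSet (x₀ : M) :
    ∀ᶠ x in 𝓝 x₀, x ∈ (trivializationAt E (TangentSpace 𝓘(ℝ, E)) x₀).baseSet :=
  (trivializationAt E (TangentSpace 𝓘(ℝ, E)) x₀).open_baseSet.mem_nhds
    (FiberBundle.mem_baseSet_trivializationAt' x₀)

theorem ofModel_toModel {x₀ x : M}
    (hx : x ∈ (trivializationAt E (TangentSpace 𝓘(ℝ, E)) x₀).baseSet)
    (v : TangentSpace 𝓘(ℝ, E) x) : ofModel E x₀ x (toModel E x₀ x v) = v :=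
  Trivialization.symmL_continuousLinearMapAt _ hx v

theorem toModel_ofModel {x₀ x : M}
    (hx : x ∈ (trivializationAt E (TangentSpace 𝓘(ℝ, E)) x₀).baseSet) (v : E) :
    toModel E x₀ x (ofModel E x₀ x v) = v :=
  Trivialization.continuousLinearMapAt_symmL _ hx v

/-- This and its analogues below replace bundle sections by maps into a fixed normed space, where
smoothness of restrictions follows by composing linear maps. -/
theorem contMDiffAt_oneForm_iff {α : ∀ x : M, TangentSpace 𝓘(ℝ, E) x →L[ℝ] ℝ} {x₀ : M} :
    ContMDiffAt 𝓘(ℝ, E) (𝓘(ℝ, E).prod 𝓘(ℝ, E →L[ℝ] ℝ)) ∞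
      (fun x ↦ TotalSpace.mk' (E →L[ℝ] ℝ)
        (E := fun x : M ↦ TangentSpace 𝓘(ℝ, E) x →L[ℝ] ℝ) x (α x)) x₀ ↔
    ContMDiffAt 𝓘(ℝ, E) 𝓘(ℝ, E →L[ℝ] ℝ) ∞ (fun x ↦ (α x).comp (ofModel E x₀ x)) x₀ := by
  refine (contMDiffAt_hom_bundle _).trans ((and_iff_right contMDiffAt_id).trans ?_)
  refine Filter.EventuallyEq.contMDiffAt_iff ?_
  filter_upwards with x
  ext v
  simp [ContinuousLinearMap.inCoordinates, ofModel]

theorem contMDiffAt_endomorphism_iff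
    {φ : ∀ x : M, TangentSpace 𝓘(ℝ, E) x →L[ℝ] TangentSpace 𝓘(ℝ, E) x} {x₀ : M} :
    ContMDiffAt 𝓘(ℝ, E) (𝓘(ℝ, E).prod 𝓘(ℝ, E →L[ℝ] E)) ∞
      (fun x ↦ TotalSpace.mk' (E →L[ℝ] E)
        (E := fun x : M ↦ TangentSpace 𝓘(ℝ, E) x →L[ℝ] TangentSpace 𝓘(ℝ, E) x) x (φ x)) x₀ ↔
    ContMDiffAt 𝓘(ℝ, E) 𝓘(ℝ, E →L[ℝ] E) ∞
      (fun x ↦ (toModel E x₀ x).comp ((φ x).comp (ofModel E x₀ x))) x₀ := by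
  refine (contMDiffAt_hom_bundle _).trans ((and_iff_right contMDiffAt_id).trans ?_)
  rfl

theorem contMDiffAt_vectorField_iff {Z : ∀ x : M, TangentSpace 𝓘(ℝ, E) x} {x₀ : M} :
    ContMDiffAt 𝓘(ℝ, E) 𝓘(ℝ, E).tangent ∞
      (fun x ↦ (⟨x, Z x⟩ : TangentBundle 𝓘(ℝ, E) M)) x₀ ↔
    ContMDiffAt 𝓘(ℝ, E) 𝓘(ℝ, E) ∞ (fun x ↦ toModel E x₀ x (Z x)) x₀ := by
  refine contMDiffAt_totalSpace.trans ((and_iff_right contMDiffAt_id).trans ?_)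
  refine Filter.EventuallyEq.contMDiffAt_iff ?_
  filter_upwards [eventually_mem_baseSet E x₀] with x hx
  simp only [toModel]
  rw [Trivialization.continuousLinearMapAt_apply, Trivialization.coe_linearMapAt_of_mem _ hx]

/-- The pullback of a bilinear form by a linear map. -/
def pullbackBilin {E F : Type*} [NormedAddCommGroup E] [NormedSpace ℝ E] [NormedAddCommGroup F]
    [NormedSpace ℝ F] (b : E →L[ℝ] E →L[ℝ] ℝ) (A : F →L[ℝ] E) : F →L[ℝ] F →L[ℝ] ℝ :=
  b.bilinearComp A A

set_option synthInstance.maxHeartbeats 200000 in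
theorem contMDiffAt_pullbackBilin {E F : Type*} [NormedAddCommGroup E] [NormedSpace ℝ E]
    [NormedAddCommGroup F] [NormedSpace ℝ F] {L : Type*} [TopologicalSpace L] [ChartedSpace F L]
    {b : L → E →L[ℝ] E →L[ℝ] ℝ} {A : L → F →L[ℝ] E} {p : L}
    (hb : ContMDiffAt 𝓘(ℝ, F) 𝓘(ℝ, E →L[ℝ] E →L[ℝ] ℝ) ∞ b p)
    (hA : ContMDiffAt 𝓘(ℝ, F) 𝓘(ℝ, F →L[ℝ] E) ∞ A p) :
    ContMDiffAt 𝓘(ℝ, F) 𝓘(ℝ, F →L[ℝ] F →L[ℝ] ℝ) ∞ (fun q ↦ pullbackBilin (b q) (A q)) p := by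
  have hpre : ContMDiffAt 𝓘(ℝ, F) 𝓘(ℝ, (E →L[ℝ] ℝ) →L[ℝ] (F →L[ℝ] ℝ)) ∞
      (fun q ↦ (ContinuousLinearMap.compL ℝ F E ℝ).flip (A q)) p :=
    contMDiffAt_const.clm_apply hA
  exact hpre.clm_comp (hb.clm_comp hA)

theorem isVonNBounded_pullbackBilin {E F : Type*} [NormedAddCommGroup E] [NormedSpace ℝ E]
    [FiniteDimensional ℝ E] [NormedAddCommGroup F] [NormedSpace ℝ F] [FiniteDimensional ℝ F]
    {b : E →L[ℝ] E →L[ℝ] ℝ} {A : F →L[ℝ] E} (hA : Function.Injective A)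
    (hb : Bornology.IsVonNBounded ℝ {v | b v v < 1}) :
    Bornology.IsVonNBounded ℝ {v | pullbackBilin b A v v < 1} := by
  obtain ⟨B, hB⟩ := ContinuousLinearMap.HasLeftInverse.of_injective_of_finiteDimensional hA
  refine (hb.image B).subset fun v hv ↦ ?_
  exact ⟨A v, hv, hB v⟩

/-- A bilinear form read in the trivialization of the tangent bundle at `x₀`. -/
def bilinInModel (x₀ x : M) (b : TangentSpace 𝓘(ℝ, E) x →L[ℝ] TangentSpace 𝓘(ℝ, E) x →L[ℝ] ℝ) :
    E →L[ℝ] E →L[ℝ] ℝ :=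
  pullbackBilin (E := E) (F := E) b (ofModel E x₀ x)

theorem contMDiffAt_bilin_iff
    {b : ∀ x : M, TangentSpace 𝓘(ℝ, E) x →L[ℝ] TangentSpace 𝓘(ℝ, E) x →L[ℝ] ℝ} {x₀ : M} :
    ContMDiffAt 𝓘(ℝ, E) (𝓘(ℝ, E).prod 𝓘(ℝ, E →L[ℝ] E →L[ℝ] ℝ)) ∞
      (fun x ↦ TotalSpace.mk' (E →L[ℝ] E →L[ℝ] ℝ)
        (E := fun x : M ↦ TangentSpace 𝓘(ℝ, E) x →L[ℝ] TangentSpace 𝓘(ℝ, E) x →L[ℝ] ℝ)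
        x (b x)) x₀ ↔
    ContMDiffAt 𝓘(ℝ, E) 𝓘(ℝ, E →L[ℝ] E →L[ℝ] ℝ) ∞ (fun x ↦ bilinInModel x₀ x (b x)) x₀ := by
  refine (contMDiffAt_hom_bundle _).trans ((and_iff_right contMDiffAt_id).trans ?_)
  refine Filter.EventuallyEq.contMDiffAt_iff ?_
  filter_upwards [eventually_mem_baseSet E x₀] with x hx
  ext v w
  rw [inCoordinates_apply_eq₂ hx hx (by simp)]
  have hs (v : E) : (trivializationAt E (TangentSpace 𝓘(ℝ, E)) x₀).symm x v = ofModel E x₀ x v :=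
    (Trivialization.symmL_apply _ hx v).symm
  simp only [Trivial.fiberBundle_trivializationAt', Bundle.Trivial.linearMapAt_trivialization,
    LinearMap.id_apply, hs]
  rfl

end Coordinates

/-! ### Restricting smooth tensor fields to an immersed manifold. -/

section Immersion

variable {E : Type*} [NormedAddCommGroup E] [NormedSpace ℝ E]
  {M : Type*} [TopologicalSpace M] [ChartedSpace E M] [IsManifold 𝓘(ℝ, E) ∞ M]
  {F : Type*} [NormedAddCommGroup F] [NormedSpace ℝ F]
  {L : Type*} [TopologicalSpace L] [ChartedSpace F L] [IsManifold 𝓘(ℝ, F) ∞ L]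
  {ι : L → M}

variable (E F) in
/-- The derivative of `ι` read in the trivializations of the tangent bundles at `p` and `ι p`. -/
def derivInModel (ι : L → M) (p q : L) : F →L[ℝ] E :=
  (toModel E (ι p) (ι q)).comp ((mfderiv 𝓘(ℝ, F) 𝓘(ℝ, E) ι q).comp (ofModel F p q))

theorem contMDiffAt_derivInModel (hι : ContMDiff 𝓘(ℝ, F) 𝓘(ℝ, E) ∞ ι) (p : L) :
    ContMDiffAt 𝓘(ℝ, F) 𝓘(ℝ, F →L[ℝ] E) ∞ (derivInModel E F ι p) p :=
  (hι p).mfderiv_const (m := ∞) (n := ∞) le_rfl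

theorem eventually_ofModel_derivInModel (hι : ContMDiff 𝓘(ℝ, F) 𝓘(ℝ, E) ∞ ι) (p : L) :
    ∀ᶠ q in 𝓝 p, ∀ v, ofModel E (ι p) (ι q) (derivInModel E F ι p q v) =
      mfderiv 𝓘(ℝ, F) 𝓘(ℝ, E) ι q (ofModel F p q v) := by
  filter_upwards [hι.continuous.continuousAt.eventually (eventually_mem_baseSet E (ι p))] with q hq v
  exact ofModel_toModel hq _

theorem eventually_derivInModel_toModel (ι : L → M) (p : L) :
    ∀ᶠ q in 𝓝 p, ∀ v, derivInModel E F ι p q (toModel F p q v) =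
      toModel E (ι p) (ι q) (mfderiv 𝓘(ℝ, F) 𝓘(ℝ, E) ι q v) := by
  filter_upwards [eventually_mem_baseSet F p] with q hq v
  simp only [derivInModel, ContinuousLinearMap.comp_apply, ofModel_toModel hq]

/-- An immersion has, locally in coordinates, a smooth family of left inverses of its derivative. -/
theorem exists_leftInverse_derivInModel [FiniteDimensional ℝ F] [FiniteDimensional ℝ E]
    (hι : ContMDiff 𝓘(ℝ, F) 𝓘(ℝ, E) ∞ ι) (p : L)
    (hinj : Function.Injective (mfderiv 𝓘(ℝ, F) 𝓘(ℝ, E) ι p)) :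
    ∃ R : L → E →L[ℝ] F, ContMDiffAt 𝓘(ℝ, F) 𝓘(ℝ, E →L[ℝ] F) ∞ R p ∧
      ∀ᶠ q in 𝓝 p, ∀ v, R q (derivInModel E F ι p q v) = v := by
  have hA := contMDiffAt_derivInModel hι p
  have hpF := FiberBundle.mem_baseSet_trivializationAt' (F := F) (E := TangentSpace 𝓘(ℝ, F)) p
  have hpE := FiberBundle.mem_baseSet_trivializationAt' (F := E) (E := TangentSpace 𝓘(ℝ, E)) (ι p)
  have hAinj : Function.Injective (derivInModel E F ι p p) := by
    intro v w hvw
    have h1 := congrArg (ofModel E (ι p) (ι p)) hvw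
    simp only [derivInModel, ContinuousLinearMap.comp_apply, ofModel_toModel hpE] at h1
    have h2 := congrArg (toModel F p p) (hinj h1)
    rwa [toModel_ofModel hpF, toModel_ofModel hpF] at h2
  -- One left inverse `B` at `p` is enough: with `A q` the derivative at `q`, `B ∘ A q` is the
  -- identity at `p` and hence invertible nearby, and `(B ∘ A q)⁻¹ ∘ B` is a left inverse depending
  -- smoothly on `q`.
  obtain ⟨B, hB⟩ :=
    ContinuousLinearMap.HasLeftInverse.of_injective_of_finiteDimensional hAinj
  have hBA : ContMDiffAt 𝓘(ℝ, F) 𝓘(ℝ, F →L[ℝ] F) ∞ (fun q ↦ B.comp (derivInModel E F ι p q)) p :=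
    contMDiffAt_const.clm_comp hA
  have h1 : B.comp (derivInModel E F ι p p) = ContinuousLinearMap.id ℝ F := by
    ext v; exact hB v
  have hcomplete : CompleteSpace F := FiniteDimensional.complete ℝ F
  have hinv : ContMDiffAt 𝓘(ℝ, F) 𝓘(ℝ, F →L[ℝ] F) ∞
      (fun q ↦ ContinuousLinearMap.inverse (B.comp (derivInModel E F ι p q))) p := by
    have hd : ContDiffAt ℝ ∞ (ContinuousLinearMap.inverse : (F →L[ℝ] F) → F →L[ℝ] F)
        (B.comp (derivInModel E F ι p p)) := by
      rw [h1]
      exact contDiffAt_map_inverse (ContinuousLinearEquiv.refl ℝ F)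
    exact ContMDiffAt.comp (I' := 𝓘(ℝ, F →L[ℝ] F)) p hd.contMDiffAt hBA
  refine ⟨fun q ↦ (ContinuousLinearMap.inverse (B.comp (derivInModel E F ι p q))).comp B,
    hinv.clm_comp contMDiffAt_const, ?_⟩
  have hopen : ∀ᶠ q in 𝓝 p, (B.comp (derivInModel E F ι p q)).IsInvertible := by
    have hnhds := (ContinuousLinearEquiv.refl ℝ F).nhds
    have hcont := hBA.continuousAt
    rw [ContinuousAt, h1] at hcont
    exact hcont.eventually hnhds
  filter_upwards [hopen] with q hq v
  obtain ⟨e, he⟩ := hq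
  simp only [ContinuousLinearMap.comp_apply]
  have : B (derivInModel E F ι p q v) = e v := by
    rw [← ContinuousLinearMap.comp_apply, ← he]; rfl
  rw [← he, ContinuousLinearMap.inverse_equiv, this]
  simp

theorem SmoothOneForm.restrictForm {α : ∀ x : M, TangentSpace 𝓘(ℝ, E) x →L[ℝ] ℝ}
    (hα : SmoothOneForm α) (hι : ContMDiff 𝓘(ℝ, F) 𝓘(ℝ, E) ∞ ι) :
    SmoothOneForm (restrictForm (F := F) ι α) := by
  intro p
  rw [contMDiffAt_oneForm_iff]
  have h := (ContMDiffAt.comp p (contMDiffAt_oneForm_iff.1 (hα (ι p))) (hι p)).clm_comp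
    (contMDiffAt_derivInModel hι p)
  refine h.congr_of_eventuallyEq ?_
  filter_upwards [eventually_ofModel_derivInModel hι p] with q hq
  ext v
  exact congrArg (α (ι q)) (hq v).symm

/-- Near `p`, `Y` is recovered from `Z` along `ι` by applying the smooth left inverse of the
derivative. The same device handles endomorphisms. -/
theorem smoothVectorField_of_mfderiv_eq [FiniteDimensional ℝ F] [FiniteDimensional ℝ E]
    (hι : ContMDiff 𝓘(ℝ, F) 𝓘(ℝ, E) ∞ ι)
    (hinj : ∀ p, Function.Injective (mfderiv 𝓘(ℝ, F) 𝓘(ℝ, E) ι p))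
    {Z : ∀ x : M, TangentSpace 𝓘(ℝ, E) x} (hZ : SmoothVectorField Z)
    {Y : ∀ p : L, TangentSpace 𝓘(ℝ, F) p}
    (hY : ∀ p, mfderiv 𝓘(ℝ, F) 𝓘(ℝ, E) ι p (Y p) = Z (ι p)) : SmoothVectorField Y := by
  intro p
  rw [contMDiffAt_vectorField_iff]
  obtain ⟨R, hR, hRA⟩ := exists_leftInverse_derivInModel hι p (hinj p)
  have h := hR.clm_apply (ContMDiffAt.comp p (contMDiffAt_vectorField_iff.1 (hZ (ι p))) (hι p))
  refine h.congr_of_eventuallyEq ?_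
  filter_upwards [hRA, eventually_derivInModel_toModel (E := E) (F := F) ι p] with q hq hq'
  rw [← hq (toModel F p q (Y q)), hq', hY]
  rfl

theorem smoothEndomorphism_of_mfderiv_eq [FiniteDimensional ℝ F] [FiniteDimensional ℝ E]
    (hι : ContMDiff 𝓘(ℝ, F) 𝓘(ℝ, E) ∞ ι)
    (hinj : ∀ p, Function.Injective (mfderiv 𝓘(ℝ, F) 𝓘(ℝ, E) ι p))
    {φ : ∀ x : M, TangentSpace 𝓘(ℝ, E) x →L[ℝ] TangentSpace 𝓘(ℝ, E) x}
    (hφ : SmoothEndomorphism φ)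
    {ψ : ∀ p : L, TangentSpace 𝓘(ℝ, F) p →L[ℝ] TangentSpace 𝓘(ℝ, F) p}
    (hψ : ∀ p v, mfderiv 𝓘(ℝ, F) 𝓘(ℝ, E) ι p (ψ p v) =
      φ (ι p) (mfderiv 𝓘(ℝ, F) 𝓘(ℝ, E) ι p v)) : SmoothEndomorphism ψ := by
  intro p
  rw [contMDiffAt_endomorphism_iff]
  obtain ⟨R, hR, hRA⟩ := exists_leftInverse_derivInModel hι p (hinj p)
  have h := hR.clm_comp ((ContMDiffAt.comp p (contMDiffAt_endomorphism_iff.1 (hφ (ι p)))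
    (hι p)).clm_comp (contMDiffAt_derivInModel hι p))
  refine h.congr_of_eventuallyEq ?_
  filter_upwards [hRA, eventually_derivInModel_toModel (E := E) (F := F) ι p,
    eventually_ofModel_derivInModel hι p] with q hq hq' hq''
  ext v
  simp only [ContinuousLinearMap.comp_apply, Function.comp_apply]
  rw [← hq (toModel F p q (ψ q (ofModel F p q v))), hq', hψ, hq'']

/-- The pullback of a Riemannian metric by an immersion. -/
def restrictMetric [FiniteDimensional ℝ F] [FiniteDimensional ℝ E]
    (hι : ContMDiff 𝓘(ℝ, F) 𝓘(ℝ, E) ∞ ι)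
    (hinj : ∀ p, Function.Injective (mfderiv 𝓘(ℝ, F) 𝓘(ℝ, E) ι p))
    (g : ContMDiffRiemannianMetric 𝓘(ℝ, E) ∞ E (fun x : M ↦ TangentSpace 𝓘(ℝ, E) x)) :
    ContMDiffRiemannianMetric 𝓘(ℝ, F) ∞ F (fun p : L ↦ TangentSpace 𝓘(ℝ, F) p) where
  inner p := pullbackBilin (E := E) (F := F) (g.inner (ι p)) (mfderiv 𝓘(ℝ, F) 𝓘(ℝ, E) ι p)
  symm p v w := g.symm _ _ _
  pos p v hv := g.pos _ _ fun h ↦ hv (hinj p (h.trans (map_zero _).symm))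
  isVonNBounded p :=
    isVonNBounded_pullbackBilin (E := E) (F := F) (hinj p) (g.isVonNBounded (ι p))
  contMDiff := by
    intro p
    refine contMDiffAt_bilin_iff.2 ?_
    have hA := contMDiffAt_derivInModel hι p
    have hG := ContMDiffAt.comp p (contMDiffAt_bilin_iff.1 (g.contMDiff (ι p))) (hι p)
    refine (contMDiffAt_pullbackBilin hG hA).congr_of_eventuallyEq ?_
    filter_upwards [eventually_ofModel_derivInModel hι p] with q hq
    ext v w
    change g.inner (ι q) (mfderiv 𝓘(ℝ, F) 𝓘(ℝ, E) ι q (ofModel F p q v))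
      (mfderiv 𝓘(ℝ, F) 𝓘(ℝ, E) ι q (ofModel F p q w)) =
      g.inner (ι q) (ofModel E (ι p) (ι q) (derivInModel E F ι p q v))
        (ofModel E (ι p) (ι q) (derivInModel E F ι p q w))
    rw [hq, hq]

end Immersion

/-! ### Naturality of the exterior derivative. -/

section ExteriorDerivative

variable {E : Type*} [NormedAddCommGroup E] [NormedSpace ℝ E]
  {M : Type*} [TopologicalSpace M] [ChartedSpace E M] [IsManifold 𝓘(ℝ, E) ∞ M]
  {F : Type*} [NormedAddCommGroup F] [NormedSpace ℝ F]
  {L : Type*} [TopologicalSpace L] [ChartedSpace F L] [IsManifold 𝓘(ℝ, F) ∞ L]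
  {ι : L → M} {α : ∀ x : M, TangentSpace 𝓘(ℝ, E) x →L[ℝ] ℝ}

theorem chartForm_eq_ofModel {x z : M} (hz : z ∈ (chartAt E x).source) :
    chartForm α x (extChartAt 𝓘(ℝ, E) x z) =
      ContinuousAlternatingMap.ofSubsingleton ℝ E ℝ (0 : Fin 1) ((α z).comp (ofModel E x z)) := by
  have hz' : (extChartAt 𝓘(ℝ, E) x).symm (extChartAt 𝓘(ℝ, E) x z) = z :=
    (extChartAt 𝓘(ℝ, E) x).left_inv (by simpa using hz)
  have h := TangentBundle.symmL_trivializationAt (I := 𝓘(ℝ, E)) (𝕜 := ℝ) hz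
  simp only [modelWithCornersSelf_coe, range_id, mfderivWithin_univ] at h
  ext v
  change α ((extChartAt 𝓘(ℝ, E) x).symm (extChartAt 𝓘(ℝ, E) x z))
    (mfderiv 𝓘(ℝ, E) 𝓘(ℝ, E) (extChartAt 𝓘(ℝ, E) x).symm (extChartAt 𝓘(ℝ, E) x z) (v 0)) =
    α z (ofModel E x z (v 0))
  rw [← h]
  -- The base point occurs in the types, so it cannot be rewritten directly; reading all fibres as
  -- `E` makes the substitution possible.
  have key : ∀ (y : M) (_ : y = z) (w : E), (α y : E →L[ℝ] ℝ) w = (α z : E →L[ℝ] ℝ) w := by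
    rintro y rfl w; rfl
  exact key _ hz' _

theorem SmoothOneForm.differentiableAt_chartForm (hα : SmoothOneForm α) (x : M) :
    DifferentiableAt ℝ (chartForm α x) (extChartAt 𝓘(ℝ, E) x x) := by
  have h1 := contMDiffAt_oneForm_iff.1 (hα x)
  have hx : (extChartAt 𝓘(ℝ, E) x).symm (extChartAt 𝓘(ℝ, E) x x) = x :=
    extChartAt_to_inv x
  have h2 : ContMDiffAt 𝓘(ℝ, E) 𝓘(ℝ, E) ∞ (extChartAt 𝓘(ℝ, E) x).symm
      (extChartAt 𝓘(ℝ, E) x x) :=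
    (contMDiffOn_extChartAt_symm x).contMDiffAt (extChartAt_target_mem_nhds x)
  have h3 := ContMDiffAt.comp_of_eq (x := extChartAt 𝓘(ℝ, E) x x) h1 h2 hx
  have h4 : DifferentiableAt ℝ _ (extChartAt 𝓘(ℝ, E) x x) :=
    h3.contDiffAt.differentiableAt (by simp)
  have h5 := (ContinuousAlternatingMap.ofSubsingletonLIE (𝕜 := ℝ) (E := E)
    (F := ℝ) (0 : Fin 1)).differentiable.differentiableAt.comp _ h4
  refine h5.congr_of_eventuallyEq ?_
  filter_upwards [extChartAt_target_mem_nhds (I := 𝓘(ℝ, E)) x] with y hy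
  have hs : (extChartAt 𝓘(ℝ, E) x).symm y ∈ (chartAt E x).source := by
    simpa using (extChartAt 𝓘(ℝ, E) x).map_target hy
  have := chartForm_eq_ofModel (α := α) hs
  rw [(extChartAt 𝓘(ℝ, E) x).right_inv hy] at this
  exact this

/-- The trivializations of the tangent bundle are the derivatives of the charts, so this is the
chain rule for chart, `ι` and inverse chart. -/
theorem fderiv_writtenInExtChartAt (hι : ContMDiff 𝓘(ℝ, F) 𝓘(ℝ, E) ∞ ι) {p q : L}
    (hq : q ∈ (chartAt F p).source) (hιq : ι q ∈ (chartAt E (ι p)).source) :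
    fderiv ℝ (writtenInExtChartAt 𝓘(ℝ, F) 𝓘(ℝ, E) p ι) (extChartAt 𝓘(ℝ, F) p q) =
      derivInModel E F ι p q := by
  have hq' : q ∈ (extChartAt 𝓘(ℝ, F) p).source := by simpa using hq
  have h0 : derivInModel E F ι p q = _ :=
    inTangentCoordinates_eq_mfderiv_comp (I := 𝓘(ℝ, F)) (I' := 𝓘(ℝ, E)) (f := id) (g := ι)
      (ϕ := fun q ↦ mfderiv 𝓘(ℝ, F) 𝓘(ℝ, E) ι q) (x₀ := p) (x := q) hq hιq
  rw [h0, ← mfderiv_eq_fderiv]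
  simp only [modelWithCornersSelf_coe, range_id, mfderivWithin_univ, id]
  have hinv : (extChartAt 𝓘(ℝ, F) p).symm (extChartAt 𝓘(ℝ, F) p q) = q :=
    (extChartAt 𝓘(ℝ, F) p).left_inv hq'
  have h1 : MDifferentiableAt 𝓘(ℝ, F) 𝓘(ℝ, F) (extChartAt 𝓘(ℝ, F) p).symm
      (extChartAt 𝓘(ℝ, F) p q) := by
    have := mdifferentiableWithinAt_extChartAt_symm (I := 𝓘(ℝ, F)) (x := p)
      ((extChartAt 𝓘(ℝ, F) p).map_source hq')
    exact mdifferentiableWithinAt_univ.1 (by simpa only [modelWithCornersSelf_coe, range_id] using this)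
  have h2 : MDifferentiableAt 𝓘(ℝ, F) 𝓘(ℝ, E) ι q := (hι q).mdifferentiableAt (by simp)
  have h3 : MDifferentiableAt 𝓘(ℝ, E) 𝓘(ℝ, E) (extChartAt 𝓘(ℝ, E) (ι p)) (ι q) :=
    mdifferentiableAt_extChartAt hιq
  have h2' : ∀ r, r = q → HasMFDerivAt 𝓘(ℝ, F) 𝓘(ℝ, E) ι r
      (mfderiv 𝓘(ℝ, F) 𝓘(ℝ, E) ι q : F →L[ℝ] E) := by
    rintro _ rfl
    exact h2.hasMFDerivAt
  have h3' : ∀ r, r = q → HasMFDerivAt 𝓘(ℝ, E) 𝓘(ℝ, E) (extChartAt 𝓘(ℝ, E) (ι p)) (ι r)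
      (mfderiv 𝓘(ℝ, E) 𝓘(ℝ, E) (extChartAt 𝓘(ℝ, E) (ι p)) (ι q) : E →L[ℝ] E) := by
    rintro _ rfl
    exact h3.hasMFDerivAt
  have hc' := (h2' _ hinv).comp _ h1.hasMFDerivAt
  have hc := HasMFDerivAt.comp (f := ι ∘ (extChartAt 𝓘(ℝ, F) p).symm)
    (extChartAt 𝓘(ℝ, F) p q) (h3' _ hinv) hc'
  exact hc.mfderiv

/-- Reduces naturality of `d` on manifolds to pullback of forms between vector spaces; equality near
the point, not just at it, is needed before differentiating. -/
theorem eventually_chartForm_restrictForm (hι : ContMDiff 𝓘(ℝ, F) 𝓘(ℝ, E) ∞ ι) (p : L) :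
    chartForm (restrictForm (F := F) ι α) p =ᶠ[𝓝 (extChartAt 𝓘(ℝ, F) p p)] fun y ↦
      (chartForm α (ι p) (writtenInExtChartAt 𝓘(ℝ, F) 𝓘(ℝ, E) p ι y)).compContinuousLinearMap
        (fderiv ℝ (writtenInExtChartAt 𝓘(ℝ, F) 𝓘(ℝ, E) p ι) y) := by
  have hsrc : ∀ᶠ q in 𝓝 p, q ∈ (chartAt F p).source ∧ ι q ∈ (chartAt E (ι p)).source :=
    Filter.Eventually.and (chart_source_mem_nhds F p)
      (hι.continuous.continuousAt.eventually (chart_source_mem_nhds E (ι p)))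
  have hev := hsrc.and (eventually_ofModel_derivInModel hι p)
  rw [← extChartAt_to_inv (I := 𝓘(ℝ, F)) p] at hev
  have hev' := (continuousAt_extChartAt_symm (I := 𝓘(ℝ, F)) p).eventually hev
  filter_upwards [hev', extChartAt_target_mem_nhds (I := 𝓘(ℝ, F)) p] with y hy hyt
  rw [extChartAt_to_inv] at hy
  obtain ⟨q, hq, rfl⟩ : ∃ q ∈ (extChartAt 𝓘(ℝ, F) p).source, extChartAt 𝓘(ℝ, F) p q = y :=
    ⟨_, (extChartAt 𝓘(ℝ, F) p).map_target hyt, (extChartAt 𝓘(ℝ, F) p).right_inv hyt⟩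
  have hinv : (extChartAt 𝓘(ℝ, F) p).symm (extChartAt 𝓘(ℝ, F) p q) = q :=
    (extChartAt 𝓘(ℝ, F) p).left_inv hq
  rw [hinv] at hy
  obtain ⟨⟨h1, h2⟩, h3⟩ := hy
  have hw : writtenInExtChartAt 𝓘(ℝ, F) 𝓘(ℝ, E) p ι (extChartAt 𝓘(ℝ, F) p q) =
      extChartAt 𝓘(ℝ, E) (ι p) (ι q) := by
    simp only [writtenInExtChartAt, Function.comp_apply, hinv]
  rw [fderiv_writtenInExtChartAt hι h1 h2, hw, chartForm_eq_ofModel h1, chartForm_eq_ofModel h2]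
  ext v
  exact congrArg (α (ι q)) (h3 (v 0)).symm

/-- The exterior derivative of a `1`-form at `x` is computed in the chart at `x`. -/
theorem extD_eq_extDeriv (α : ∀ x : M, TangentSpace 𝓘(ℝ, E) x →L[ℝ] ℝ) (x : M)
    (v : Fin 2 → TangentSpace 𝓘(ℝ, E) x) :
    extD α x v = extDeriv (chartForm α x) (extChartAt 𝓘(ℝ, E) x x) v := by
  rw [extD, mfderiv_extChartAt_self]
  rfl

/-- The exterior derivative commutes with restriction to an immersed manifold. -/
theorem extD_restrictForm (hα : SmoothOneForm α) (hι : ContMDiff 𝓘(ℝ, F) 𝓘(ℝ, E) ∞ ι) (p : L) :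
    extD (restrictForm (F := F) ι α) p =
      (extD α (ι p)).compLinearMap (mfderiv 𝓘(ℝ, F) 𝓘(ℝ, E) ι p).toLinearMap := by
  have hw : writtenInExtChartAt 𝓘(ℝ, F) 𝓘(ℝ, E) p ι (extChartAt 𝓘(ℝ, F) p p) =
      extChartAt 𝓘(ℝ, E) (ι p) (ι p) := by
    simp [writtenInExtChartAt]
  have hd : DifferentiableAt ℝ (chartForm α (ι p))
      (writtenInExtChartAt 𝓘(ℝ, F) 𝓘(ℝ, E) p ι (extChartAt 𝓘(ℝ, F) p p)) := by
    rw [hw]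
    exact hα.differentiableAt_chartForm (ι p)
  have hf : ContDiffAt ℝ ∞ (writtenInExtChartAt 𝓘(ℝ, F) 𝓘(ℝ, E) p ι)
      (extChartAt 𝓘(ℝ, F) p p) := by
    have := (contMDiffAt_iff.1 (hι p)).2
    simpa [contDiffWithinAt_univ] using this
  have hpull := extDeriv_pullback hd hf (by
    rw [minSmoothness_of_isRCLikeNormedField]
    exact ENat.LEInfty.out)
  have hder : mfderiv 𝓘(ℝ, F) 𝓘(ℝ, E) ι p =
      fderiv ℝ (writtenInExtChartAt 𝓘(ℝ, F) 𝓘(ℝ, E) p ι) (extChartAt 𝓘(ℝ, F) p p) := by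
    rw [((hι p).mdifferentiableAt (by simp)).mfderiv]
    simp only [modelWithCornersSelf_coe, range_id, fderivWithin_univ]
    rfl
  ext v
  rw [AlternatingMap.compLinearMap_apply, extD_eq_extDeriv, extD_eq_extDeriv,
    (eventually_chartForm_restrictForm hι p).extDeriv_eq, hpull, hw, hder]
  rfl

theorem extD_restrictForm_apply (hα : SmoothOneForm α) (hι : ContMDiff 𝓘(ℝ, F) 𝓘(ℝ, E) ∞ ι)
    (p : L) (v w : TangentSpace 𝓘(ℝ, F) p) :
    extD (restrictForm (F := F) ι α) p ![v, w] =
      extD α (ι p) ![mfderiv 𝓘(ℝ, F) 𝓘(ℝ, E) ι p v, mfderiv 𝓘(ℝ, F) 𝓘(ℝ, E) ι p w] := by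
  rw [extD_restrictForm hα hι, AlternatingMap.compLinearMap_apply]
  congr 1
  ext i
  fin_cases i <;> rfl

theorem wedgePow_extD_restrictForm (hα : SmoothOneForm α)
    (hι : ContMDiff 𝓘(ℝ, F) 𝓘(ℝ, E) ∞ ι) {m : ℕ} (h : ∀ x, wedgePow (extD α x) m = 0) (p : L) :
    wedgePow (extD (restrictForm (F := F) ι α) p) m = 0 := by
  rw [extD_restrictForm hα hι, wedgePow_compLinearMap, h]
  rfl

/-- `dα` vanishes on the integral manifolds of its kernel. -/
theorem IsConnectedIntegralManifold.extD_eq_zero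
    (hι : IsConnectedIntegralManifold (F := F) (kerD α) ι) (hα : SmoothOneForm α) (p : L) :
    extD (restrictForm (F := F) ι α) p = 0 := by
  ext v
  have hv : v = ![v 0, v 1] := by
    ext i; fin_cases i <;> rfl
  have hmem : mfderiv 𝓘(ℝ, F) 𝓘(ℝ, E) ι p (v 0) ∈ kerD α (ι p) := by
    rw [← hι.tangent p]
    exact ⟨v 0, rfl⟩
  rw [hv, extD_restrictForm_apply hα hι.smooth]
  exact hmem _

end ExteriorDerivative

theorem IsConnectedIntegralManifold.finrank_eq {E : Type*} [NormedAddCommGroup E] [NormedSpace ℝ E]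
    {M : Type*} [TopologicalSpace M] [ChartedSpace E M]
    {F : Type*} [NormedAddCommGroup F] [NormedSpace ℝ F]
    {L : Type*} [TopologicalSpace L] [ChartedSpace F L]
    {ι : L → M} {D : ∀ x : M, Submodule ℝ (TangentSpace 𝓘(ℝ, E) x)}
    (hι : IsConnectedIntegralManifold (F := F) D ι) {d : ℕ}
    (hD : ∀ x, Module.finrank ℝ (D x) = d) : Module.finrank ℝ F = d := by
  obtain ⟨p⟩ := hι.connected.toNonempty
  rw [← hD (ι p), ← hι.tangent p, LinearMap.finrank_range_of_inj (hι.immersion p)]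
  rfl

/-! ### The induced structure on integral manifolds. -/

section Induced

variable {E : Type*} [NormedAddCommGroup E] [NormedSpace ℝ E] [FiniteDimensional ℝ E]
  {M : Type*} [TopologicalSpace M] [ChartedSpace E M] [IsManifold 𝓘(ℝ, E) ∞ M]
  {F : Type*} [NormedAddCommGroup F] [NormedSpace ℝ F] [FiniteDimensional ℝ F]
  {L : Type*} [TopologicalSpace L] [ChartedSpace F L] [IsManifold 𝓘(ℝ, F) ∞ L]
  {ι : L → M} {D : ∀ x : M, Submodule ℝ (TangentSpace 𝓘(ℝ, E) x)}
  {α₁ α₂ : ∀ x : M, TangentSpace 𝓘(ℝ, E) x →L[ℝ] ℝ}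
  {φ : ∀ x : M, TangentSpace 𝓘(ℝ, E) x →L[ℝ] TangentSpace 𝓘(ℝ, E) x}
  {Z₁ Z₂ : ∀ x : M, TangentSpace 𝓘(ℝ, E) x}
  {g : ContMDiffRiemannianMetric 𝓘(ℝ, E) ∞ E (fun x : M ↦ TangentSpace 𝓘(ℝ, E) x)}

/-- The structure tensors restrict to the integral manifolds of a `φ`-invariant distribution
containing the Reeb vector fields. -/
theorem IsConnectedIntegralManifold.exists_restriction
    (hι : IsConnectedIntegralManifold (F := F) D ι)
    (hα₁ : SmoothOneForm α₁) (hα₂ : SmoothOneForm α₂) (hR : IsReebPair α₁ α₂ Z₁ Z₂)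
    (hS : IsStructureTensor α₁ α₂ φ Z₁ Z₂) (hA : IsAssociated α₁ α₂ φ Z₁ Z₂ g)
    (hZ₁ : ∀ x, Z₁ x ∈ D x) (hZ₂ : ∀ x, Z₂ x ∈ D x) (hφ : ∀ x, ∀ v ∈ D x, φ x v ∈ D x) :
    ∃ (φL : ∀ p : L, TangentSpace 𝓘(ℝ, F) p →L[ℝ] TangentSpace 𝓘(ℝ, F) p)
      (gL : ContMDiffRiemannianMetric 𝓘(ℝ, F) ∞ F (fun p : L ↦ TangentSpace 𝓘(ℝ, F) p))
      (Y₁ Y₂ : ∀ p : L, TangentSpace 𝓘(ℝ, F) p),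
      (∀ p v, mfderiv 𝓘(ℝ, F) 𝓘(ℝ, E) ι p (φL p v) =
        φ (ι p) (mfderiv 𝓘(ℝ, F) 𝓘(ℝ, E) ι p v)) ∧
      (∀ p v w, gL.inner p v w =
        g.inner (ι p) (mfderiv 𝓘(ℝ, F) 𝓘(ℝ, E) ι p v) (mfderiv 𝓘(ℝ, F) 𝓘(ℝ, E) ι p w)) ∧
      IsReebPair (restrictForm (F := F) ι α₁) (restrictForm (F := F) ι α₂) Y₁ Y₂ ∧
      IsStructureTensor (restrictForm (F := F) ι α₁) (restrictForm (F := F) ι α₂) φL Y₁ Y₂ ∧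
      IsAssociated (restrictForm (F := F) ι α₁) (restrictForm (F := F) ι α₂) φL Y₁ Y₂ gL := by
  -- The left inverses are chosen point by point with no regularity. On `D` they invert `dι`, so the
  -- restricted tensors do not depend on the choice, and their smoothness is proved from the
  -- relations `hY₁`, `hY₂` and `hφL`.
  have hB (p : L) : ∃ B : TangentSpace 𝓘(ℝ, E) (ι p) →L[ℝ] TangentSpace 𝓘(ℝ, F) p,
      ∀ v, B (mfderiv 𝓘(ℝ, F) 𝓘(ℝ, E) ι p v) = v :=
    ContinuousLinearMap.HasLeftInverse.of_injective_of_finiteDimensional (𝕜 := ℝ) (E := F) (F := E)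
      (hι.immersion p)
  choose B hB using hB
  have hBD (p : L) (w : TangentSpace 𝓘(ℝ, E) (ι p)) (hw : w ∈ D (ι p)) :
      mfderiv 𝓘(ℝ, F) 𝓘(ℝ, E) ι p (B p w) = w := by
    rw [← hι.tangent p] at hw
    obtain ⟨v, rfl⟩ := hw
    exact congrArg (mfderiv 𝓘(ℝ, F) 𝓘(ℝ, E) ι p) (hB p v)
  have hD (p : L) (v : TangentSpace 𝓘(ℝ, F) p) :
      mfderiv 𝓘(ℝ, F) 𝓘(ℝ, E) ι p v ∈ D (ι p) := by
    rw [← hι.tangent p]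
    exact ⟨v, rfl⟩
  let φL : ∀ p : L, TangentSpace 𝓘(ℝ, F) p →L[ℝ] TangentSpace 𝓘(ℝ, F) p := fun p ↦
    (B p).comp ((φ (ι p)).comp (mfderiv 𝓘(ℝ, F) 𝓘(ℝ, E) ι p))
  let Y₁ : ∀ p : L, TangentSpace 𝓘(ℝ, F) p := fun p ↦ B p (Z₁ (ι p))
  let Y₂ : ∀ p : L, TangentSpace 𝓘(ℝ, F) p := fun p ↦ B p (Z₂ (ι p))
  have hY₁ (p : L) : mfderiv 𝓘(ℝ, F) 𝓘(ℝ, E) ι p (Y₁ p) = Z₁ (ι p) := hBD p _ (hZ₁ _)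
  have hY₂ (p : L) : mfderiv 𝓘(ℝ, F) 𝓘(ℝ, E) ι p (Y₂ p) = Z₂ (ι p) := hBD p _ (hZ₂ _)
  have hφL (p : L) (v : TangentSpace 𝓘(ℝ, F) p) : mfderiv 𝓘(ℝ, F) 𝓘(ℝ, E) ι p (φL p v) =
      φ (ι p) (mfderiv 𝓘(ℝ, F) 𝓘(ℝ, E) ι p v) := hBD p _ (hφ _ _ (hD p v))
  have hr (α : ∀ x : M, TangentSpace 𝓘(ℝ, E) x →L[ℝ] ℝ) (p : L) (v : TangentSpace 𝓘(ℝ, F) p) :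
      restrictForm (F := F) ι α p v = α (ι p) (mfderiv 𝓘(ℝ, F) 𝓘(ℝ, E) ι p v) := rfl
  refine ⟨φL, restrictMetric hι.smooth hι.immersion g, Y₁, Y₂, hφL, fun _ _ _ ↦ rfl, ?_, ?_, ?_⟩
  · exact
      { smooth₁ := smoothVectorField_of_mfderiv_eq hι.smooth hι.immersion hR.smooth₁ hY₁
        smooth₂ := smoothVectorField_of_mfderiv_eq hι.smooth hι.immersion hR.smooth₂ hY₂
        apply₁₁ := fun p ↦ by rw [hr, hY₁, hR.apply₁₁]
        apply₂₂ := fun p ↦ by rw [hr, hY₂, hR.apply₂₂]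
        apply₁₂ := fun p ↦ by rw [hr, hY₂, hR.apply₁₂]
        apply₂₁ := fun p ↦ by rw [hr, hY₁, hR.apply₂₁]
        contract₁₁ := fun p v ↦ by
          rw [extD_restrictForm_apply hα₁ hι.smooth, hY₁, hR.contract₁₁]
        contract₂₁ := fun p v ↦ by
          rw [extD_restrictForm_apply hα₂ hι.smooth, hY₁, hR.contract₂₁]
        contract₁₂ := fun p v ↦ by
          rw [extD_restrictForm_apply hα₁ hι.smooth, hY₂, hR.contract₁₂]
        contract₂₂ := fun p v ↦ by
          rw [extD_restrictForm_apply hα₂ hι.smooth, hY₂, hR.contract₂₂] }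
  · exact
      { smooth := smoothEndomorphism_of_mfderiv_eq hι.smooth hι.immersion hS.smooth hφL
        -- By injectivity of `dι`, identities between tangent vectors of `L` can be checked after
        -- pushing them forward to `M`.
        sq := fun p v ↦ hι.immersion p <| by
          rw [hφL, hφL, hS.sq, map_add, map_add, map_neg, map_smul, map_smul, hY₁, hY₂]
          rfl
        apply_reeb₁ := fun p ↦ hι.immersion p <| by rw [hφL, hY₁, hS.apply_reeb₁, map_zero]
        apply_reeb₂ := fun p ↦ hι.immersion p <| by rw [hφL, hY₂, hS.apply_reeb₂, map_zero] }
  · have hg (p : L) (v w : TangentSpace 𝓘(ℝ, F) p) :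
        (restrictMetric hι.smooth hι.immersion g).inner p v w = g.inner (ι p)
          (mfderiv 𝓘(ℝ, F) 𝓘(ℝ, E) ι p v) (mfderiv 𝓘(ℝ, F) 𝓘(ℝ, E) ι p w) := rfl
    exact
      { inner_apply := fun p v w ↦ by
          rw [extD_restrictForm_apply hα₁ hι.smooth, extD_restrictForm_apply hα₂ hι.smooth, hg,
            hφL, hA.inner_apply]
        inner_reeb₁ := fun p v ↦ by rw [hg, hY₁, hA.inner_reeb₁]; rfl
        inner_reeb₂ := fun p v ↦ by rw [hg, hY₂, hA.inner_reeb₂]; rfl }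

theorem IsConnectedIntegralManifold.induces_of_kerD_right {h k : ℕ}
    (hι : IsConnectedIntegralManifold (F := F) (kerD α₂) ι)
    (hM : IsMetricContactPair α₁ α₂ φ g h k) (hφ : IsDecomposable α₁ α₂ φ) :
    InducesMetricContactPair (F := F) ι α₁ α₂ φ g h 0 := by
  obtain ⟨hC, Z₁, Z₂, hR, hS, hA⟩ := hM
  obtain ⟨φL, gL, Y₁, Y₂, hφL, hgL, hRL, hSL, hAL⟩ := hι.exists_restriction hC.smooth₁ hC.smooth₂
    hR hS hA hR.contract₂₁ hR.contract₂₂ fun x ↦ (map_mem_kerD_of_decomposable hφ hR hS x).2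
  refine ⟨φL, gL, hφL, hgL, ?_, Y₁, Y₂, hRL, hSL, hAL⟩
  exact isContactPair_of_extD_right_eq_zero (hC.smooth₁.restrictForm hι.smooth)
    (hC.smooth₂.restrictForm hι.smooth)
    (hι.finrank_eq fun x ↦ (finrank_kerD hC hR hS hA x).2) hRL hSL hAL
    (wedgePow_extD_restrictForm hC.smooth₁ hι.smooth hC.pow₁) (hι.extD_eq_zero hC.smooth₂)

theorem IsConnectedIntegralManifold.induces_of_kerD_left {h k : ℕ}
    (hι : IsConnectedIntegralManifold (F := F) (kerD α₁) ι)
    (hM : IsMetricContactPair α₁ α₂ φ g h k) (hφ : IsDecomposable α₁ α₂ φ) :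
    InducesMetricContactPair (F := F) ι α₁ α₂ φ g 0 k := by
  obtain ⟨hC, Z₁, Z₂, hR, hS, hA⟩ := hM
  obtain ⟨φL, gL, Y₁, Y₂, hφL, hgL, hRL, hSL, hAL⟩ := hι.exists_restriction hC.smooth₁ hC.smooth₂
    hR hS hA hR.contract₁₁ hR.contract₁₂ fun x ↦ (map_mem_kerD_of_decomposable hφ hR hS x).1
  refine ⟨φL, gL, hφL, hgL, ?_, Y₁, Y₂, hRL, hSL, hAL⟩
  exact isContactPair_of_extD_left_eq_zero (hC.smooth₁.restrictForm hι.smooth)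
    (hC.smooth₂.restrictForm hι.smooth)
    (hι.finrank_eq fun x ↦ (finrank_kerD hC hR hS hA x).1) hRL hSL hAL
    (wedgePow_extD_restrictForm hC.smooth₂ hι.smooth hC.pow₂) (hι.extD_eq_zero hC.smooth₁)

end Induced
end ContactPair
end

theorem mainTheorem5 {n : ℕ} {M : Type u} [TopologicalSpace M] [T2Space M]
    [SecondCountableTopology M] [ChartedSpace (EuclideanSpace ℝ (Fin n)) M]
    [IsManifold (𝓡 n) ∞ M] (h k : ℕ)
    (α₁ α₂ : ∀ x : M, TangentSpace (𝓡 n) x →L[ℝ] ℝ)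
    (φ : ∀ x : M, TangentSpace (𝓡 n) x →L[ℝ] TangentSpace (𝓡 n) x)
    (g : ContMDiffRiemannianMetric (𝓡 n) ∞ (EuclideanSpace ℝ (Fin n))
      (fun x : M ↦ TangentSpace (𝓡 n) x))
    (hMCP : ContactPair.IsMetricContactPair α₁ α₂ φ g h k)
    (hφ : ContactPair.IsDecomposable α₁ α₂ φ) :
    (∀ (m : ℕ) (L : Type u) [TopologicalSpace L] [ChartedSpace (EuclideanSpace ℝ (Fin m)) L]
      [IsManifold (𝓡 m) ∞ L] (ι : L → M),
      ContactPair.IsLeaf (F := EuclideanSpace ℝ (Fin m)) (ContactPair.kerD (E := EuclideanSpace ℝ (Fin n)) α₂) ι →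
        ContactPair.InducesMetricContactPair (E := EuclideanSpace ℝ (Fin n))
          (F := EuclideanSpace ℝ (Fin m)) ι α₁ α₂ φ g h 0) ∧
    (∀ (m : ℕ) (L : Type u) [TopologicalSpace L] [ChartedSpace (EuclideanSpace ℝ (Fin m)) L]
      [IsManifold (𝓡 m) ∞ L] (ι : L → M),
      ContactPair.IsLeaf (F := EuclideanSpace ℝ (Fin m)) (ContactPair.kerD (E := EuclideanSpace ℝ (Fin n)) α₁) ι →
        ContactPair.InducesMetricContactPair (E := EuclideanSpace ℝ (Fin n))
          (F := EuclideanSpace ℝ (Fin m)) ι α₁ α₂ φ g 0 k) := by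
  exact ⟨fun _ _ _ _ _ _ hι ↦ hι.toIsConnectedIntegralManifold.induces_of_kerD_right hMCP hφ,
    fun _ _ _ _ _ _ hι ↦ hι.toIsConnectedIntegralManifold.induces_of_kerD_left hMCP hφ⟩
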